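/- **Setting.** Let $n\ge 1$ and $\mu>0$. On a filtered probability space $(\Omega,\mathcal F,(\mathcal F_t)_{t\ge0},\mathbb P)$ let $A$ (arrivals) and $D$ (retrial instants) be adapted point processes, i.e. adapted processes whose paths almost surely start at $0$, are nondecreasing, right-continuous and $\mathbb N$-valued, and have unit jumps. Let $\pi_1,\dots,\pi_n$ be mutually independent Poisson processes of rate $\mu$ with respect to $(\mathcal F_t)$: each $\pi_l$ is an adapted point process, and for $s\le t$ the increment $\pi_l(t)-\pi_l(s)$ is Poisson with mean $\mu(t-s)$ and independent of $\mathcal F_s$. Almost surely no two of $A,D$ jump simultaneously, and neither $A$ nor $D$ ever jumps simultaneously with some $\pi_l$. The $n$-server retrial system with one orbit place and losses is described by adapted $\mathbb N$-valued processes $Q_1$ (busy servers), $Q_2$ (customers in orbit), $Q_3$ (losses up to time $t$) such that almost surely, for all $t\ge 0$, $$Q_1(t)+Q_2(t)+Q_3(t)=A(t)-\sum_{l=1}^n\int_0^t \mathbf I\{Q_1(s-)\ge l\}\,d\pi_l(s),$$ $$Q_2(t)+Q_3(t)=\int_0^t\mathbf I\{Q_1(s-)=n\}\,dA(s)-\int_0^t\mathbf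 I\{Q_1(s-)\ne n,\ Q_2(s-)=1\}\,dD(s),$$ $$Q_3(t)=\int_0^t\mathbf I\{Q_1(s-)=n,\ Q_2(s-)=1\}\,dA(s),$$ where $\int_0^t h\,dN$ is the sum of $h(s)\,\Delta N(s)$ over the jump times $s\in(0,t]$ of $N$. **Notation.** For $N\in\{A,D\}$ put $$p_{i,j}(t)=\frac1t\int_0^t\mathbb P\{Q_1(s)=i,Q_2(s)=j\}\,ds,\qquad r^N_{i,j}(t)=\frac1t\,\mathbb E\int_0^t\mathbf I\{Q_1(s-)=i,Q_2(s-)=j\}\,dN(s).$$ **Theorem.** The random variable $\int_0^t\mathbf I\{Q_1(s-)=i,Q_2(s-)=j\}\,dA(s)$ is integrable for all $t\ge0$, $0\le i\le n$, $j\in\{0,1\}$ with $(i,j)\ne(n,1)$, and $\int_0^t\mathbf I\{Q_1(s-)=i,Q_2(s-)=1\}\,dD(s)$ is integrable for all $t\ge0$, $0\le i\le n-1$. Moreover, in the limit $t\to\infty$ the following equations hold: 1. for $i=0$ and $j=0,1$: $\displaystyle \mu\lim p_{1,j}=\lim r^A_{0,j}+j\lim r^D_{0,j}$; 2. for $1\le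 i\le n-1$ and $j=0,1$: $\displaystyle i\mu\lim p_{i,j}-(i+1)\mu\lim p_{i+1,j}=\lim\,(r^A_{i-1,j}-r^A_{i,j})+(1-j)\lim r^D_{i-1,1}-j\lim r^D_{i,1}$; 3. for $i=n$, $j=0$: $\displaystyle n\mu\lim p_{n,0}=\lim\,(r^A_{n-1,0}-r^A_{n,0})+\lim r^D_{n-1,1}$; 4. for $i=n$, $j=1$: $\displaystyle n\mu\lim p_{n,1}=\lim r^A_{n-1,1}+\lim r^A_{n,0}$. Here terms with coefficient $j=0$ or $1-j=0$ are absent. The equations are meant in both of the following senses: each of them holds whenever all the limits that occur in it exist as finite numbers; and, with no assumption on the existence of limits, for each of them the difference of its two sides, with every "$\lim$" removed, tends to $0$ as $t\to\infty$. -/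

import Mathlib

open MeasureTheory ProbabilityTheory Filter Topology Function
open scoped NNReal

noncomputable section

namespace RetrialQueue

/-- A path of a (simple, locally finite) counting process: it starts at `0`, is nondecreasing with
values in `ℕ` (so that left limits exist), is right-continuous and has jumps of size one only. -/
structure IsCountingPath (N : ℝ≥0 → ℕ) : Prop where
  zero : N 0 = 0
  mono : Monotone N
  rightCont : ∀ t, ContinuousWithinAt N (Set.Ici t) t
  unitJump : ∀ t, N t ≤ leftLim N t + 1

/-- The path integral `∫₀ᵗ h(s) dN(s)` over `(0, t]` with respect to a counting path `N`, that is,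
the sum of `h(s) ΔN(s)` over the jump times `s ∈ (0, t]` of `N`. -/
def pathIntegral (h : ℝ≥0 → ℝ) (N : ℝ≥0 → ℕ) (t : ℝ≥0) : ℝ :=
  ∑ᶠ s ∈ Set.Ioc 0 t, h s * ((N s : ℝ) - ((leftLim N s : ℕ) : ℝ))

/-- The indicator `I{q₁(s-) = i, q₂(s-) = j}` along a pair of paths. -/
def preState (q₁ q₂ : ℝ≥0 → ℕ) (i j : ℕ) (s : ℝ≥0) : ℝ :=
  if leftLim q₁ s = i ∧ leftLim q₂ s = j then 1 else 0

variable {Ω : Type*} [mΩ : MeasurableSpace Ω]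

/-- A point process adapted to the filtration `F`. -/
structure IsPointProcess (F : Filtration ℝ≥0 mΩ) (P : Measure Ω) (N : ℝ≥0 → Ω → ℕ) : Prop where
  adapted : ∀ t, Measurable[F t] (N t)
  path : ∀ᵐ ω ∂P, IsCountingPath (fun t => N t ω)

/-- A Poisson process of the given rate with respect to the filtration `F`: the increment over
`(s, t]` has the Poisson law of parameter `rate * (t - s)` and is independent of `F s`. -/
structure IsPoissonProcess (F : Filtration ℝ≥0 mΩ) (P : Measure Ω) (rate : ℝ≥0)
    (N : ℝ≥0 → Ω → ℕ) : Prop where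
  isPointProcess : IsPointProcess F P N
  law : ∀ s t, s ≤ t → P.map (fun ω => N t ω - N s ω) = poissonMeasure (rate * (t - s))
  indep : ∀ s t, s ≤ t →
    Indep (MeasurableSpace.comap (fun ω => N t ω - N s ω) ⊤) (F s) P

/-- With probability one, `N` and `M` never jump simultaneously. -/
def JumpsDisjoint (P : Measure Ω) (N M : ℝ≥0 → Ω → ℕ) : Prop :=
  ∀ᵐ ω ∂P, ∀ t, leftLim (fun s => N s ω) t = N t ω ∨ leftLim (fun s => M s ω) t = M t ω

/-- The retrial system with `n` servers, one orbit place and losses. `A` is the arrival process,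
`D` the process of retrial instants, `π l` (`l : Fin n`, with `l + 1` playing the role of the
index `1, …, n`) the Poisson process that governs the service completions, `Q₁ t` the number of
busy servers, `Q₂ t` the number of customers in orbit and `Q₃ t` the number of losses up to `t`. -/
structure IsRetrialSystem (n : ℕ) (μ : ℝ≥0) (F : Filtration ℝ≥0 mΩ) (P : Measure Ω)
    (A D : ℝ≥0 → Ω → ℕ) (π : Fin n → ℝ≥0 → Ω → ℕ) (Q₁ Q₂ Q₃ : ℝ≥0 → Ω → ℕ) : Prop where
  arrivals : IsPointProcess F P A
  retrials : IsPointProcess F P D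
  services : ∀ l, IsPoissonProcess F P μ (π l)
  services_indep : iIndepFun (fun (l : Fin n) (ω : Ω) (t : ℝ≥0) => π l t ω) P
  disjoint_arrivals_retrials : JumpsDisjoint P A D
  disjoint_arrivals_services : ∀ l, JumpsDisjoint P A (π l)
  disjoint_retrials_services : ∀ l, JumpsDisjoint P D (π l)
  adapted₁ : ∀ t, Measurable[F t] (Q₁ t)
  adapted₂ : ∀ t, Measurable[F t] (Q₂ t)
  adapted₃ : ∀ t, Measurable[F t] (Q₃ t)
  /-- all customers: those in service, in orbit and lost -/
  total : ∀ᵐ ω ∂P, ∀ t,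
    (Q₁ t ω : ℝ) + Q₂ t ω + Q₃ t ω = A t ω -
      ∑ l : Fin n, pathIntegral
        (fun s => if (l : ℕ) + 1 ≤ leftLim (fun r => Q₁ r ω) s then 1 else 0)
        (fun s => π l s ω) t
  /-- arrivals that meet busy servers, minus successful retrials -/
  orbit : ∀ᵐ ω ∂P, ∀ t,
    (Q₂ t ω : ℝ) + Q₃ t ω =
      pathIntegral (fun s => if leftLim (fun r => Q₁ r ω) s = n then 1 else 0)
        (fun s => A s ω) t -
      pathIntegral (fun s => if leftLim (fun r => Q₁ r ω) s ≠ n ∧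
        leftLim (fun r => Q₂ r ω) s = 1 then 1 else 0) (fun s => D s ω) t
  /-- losses: arrivals that meet busy servers and an occupied orbit place -/
  losses : ∀ᵐ ω ∂P, ∀ t,
    (Q₃ t ω : ℝ) =
      pathIntegral (fun s => if leftLim (fun r => Q₁ r ω) s = n ∧
        leftLim (fun r => Q₂ r ω) s = 1 then 1 else 0) (fun s => A s ω) t

/-- `t⁻¹ ∫₀ᵗ P{Q₁(s) = i, Q₂(s) = j} ds`. -/
def freq (P : Measure Ω) (Q₁ Q₂ : ℝ≥0 → Ω → ℕ) (i j : ℕ) (t : ℝ≥0) : ℝ :=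
  (t : ℝ)⁻¹ * ∫ s in (0 : ℝ)..t, P.real {ω | Q₁ s.toNNReal ω = i ∧ Q₂ s.toNNReal ω = j}

/-- The random variable `∫₀ᵗ I{Q₁(s-) = i, Q₂(s-) = j} dN(s)`. -/
def visits (Q₁ Q₂ N : ℝ≥0 → Ω → ℕ) (i j : ℕ) (t : ℝ≥0) (ω : Ω) : ℝ :=
  pathIntegral (preState (fun s => Q₁ s ω) (fun s => Q₂ s ω) i j) (fun s => N s ω) t

/-- `t⁻¹ E ∫₀ᵗ I{Q₁(s-) = i, Q₂(s-) = j} dN(s)`. -/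
def rate (P : Measure Ω) (Q₁ Q₂ N : ℝ≥0 → Ω → ℕ) (i j : ℕ) (t : ℝ≥0) : ℝ :=
  (t : ℝ)⁻¹ * ∫ ω, visits Q₁ Q₂ N i j t ω ∂P

/-- `t⁻¹ E ∫₀ᵗ [I{Q₁(s-) = i, Q₂(s-) = j} - I{Q₁(s-) = i', Q₂(s-) = j'}] dN(s)`. -/
def rateDiff (P : Measure Ω) (Q₁ Q₂ N : ℝ≥0 → Ω → ℕ) (i j i' j' : ℕ) (t : ℝ≥0) : ℝ :=
  (t : ℝ)⁻¹ * ∫ ω, pathIntegral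
    (fun s => preState (fun r => Q₁ r ω) (fun r => Q₂ r ω) i j s -
      preState (fun r => Q₁ r ω) (fun r => Q₂ r ω) i' j' s) (fun s => N s ω) t ∂P

end RetrialQueue

end

open RetrialQueue

namespace RetrialQueue

/-- A path that is constant on a right neighbourhood and on a punctured left neighbourhood of every
point, the value on the latter being the left limit. -/
structure IsStepPath {E : Type*} [TopologicalSpace E] (f : ℝ≥0 → E) : Prop where
  right : ∀ t, ∀ᶠ s in 𝓝[>] t, f s = f t
  left : ∀ t, ∀ᶠ s in 𝓝[<] t, f s = leftLim f t

/-! ### Step paths and their left limits -/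

section StepPath

variable {E E' : Type*} [TopologicalSpace E] [TopologicalSpace E']

lemma nhdsLT_neBot_of_pos {t : ℝ≥0} (ht : 0 < t) : (𝓝[<] t).NeBot :=
  nhdsLT_neBot_of_exists_lt ⟨0, ht⟩

lemma nhdsLT_zero_eq_bot : 𝓝[<] (0 : ℝ≥0) = ⊥ := by
  have : Set.Iio (0 : ℝ≥0) = ∅ := by ext x; simp
  rw [this, nhdsWithin_empty]

/-- Time 0 has no left neighbourhood, so the left limit takes its default value and no path jumps at
0. -/
lemma leftLim_zero (f : ℝ≥0 → E) : leftLim f 0 = f 0 :=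
  leftLim_eq_of_eq_bot f nhdsLT_zero_eq_bot

lemma leftLim_eq_of_eventually [T2Space E] {f : ℝ≥0 → E} {t : ℝ≥0} {y : E} (ht : 0 < t)
    (h : ∀ᶠ s in 𝓝[<] t, f s = y) : leftLim f t = y := by
  have := nhdsLT_neBot_of_pos ht
  exact leftLim_eq_of_tendsto (tendsto_const_nhds.congr' (h.mono fun s hs => hs.symm))

lemma IsStepPath.of_exists [T2Space E] {f : ℝ≥0 → E} (hr : ∀ t, ∀ᶠ s in 𝓝[>] t, f s = f t)
    (hl : ∀ t, 0 < t → ∃ y, ∀ᶠ s in 𝓝[<] t, f s = y) : IsStepPath f := by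
  refine ⟨hr, fun t => ?_⟩
  rcases eq_zero_or_pos t with rfl | ht
  · rw [nhdsLT_zero_eq_bot]; exact eventually_bot
  · obtain ⟨y, hy⟩ := hl t ht
    rwa [leftLim_eq_of_eventually ht hy]

lemma IsStepPath.comp [T2Space E'] {f : ℝ≥0 → E} (hf : IsStepPath f) (φ : E → E') :
    IsStepPath fun t => φ (f t) :=
  .of_exists (fun t => (hf.right t).mono fun s hs => by rw [hs])
    fun t _ => ⟨φ (leftLim f t), (hf.left t).mono fun s hs => by rw [hs]⟩

lemma IsStepPath.leftLim_comp [T2Space E'] {f : ℝ≥0 → E} (hf : IsStepPath f) (φ : E → E')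
    (t : ℝ≥0) :
    leftLim (fun t => φ (f t)) t = φ (leftLim f t) := by
  rcases eq_zero_or_pos t with rfl | ht
  · simp only [leftLim_zero]
  · exact leftLim_eq_of_eventually ht ((hf.left t).mono fun s hs => by rw [hs])

lemma IsStepPath.prodMk [T2Space E] [T2Space E'] {f : ℝ≥0 → E} {g : ℝ≥0 → E'}
    (hf : IsStepPath f) (hg : IsStepPath g) :
    IsStepPath fun t => (f t, g t) :=
  .of_exists (fun t => ((hf.right t).and (hg.right t)).mono fun s hs => by rw [hs.1, hs.2])
    fun t _ => ⟨(leftLim f t, leftLim g t),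
      ((hf.left t).and (hg.left t)).mono fun s hs => by rw [hs.1, hs.2]⟩

lemma IsStepPath.leftLim_prodMk [T2Space E] [T2Space E'] {f : ℝ≥0 → E} {g : ℝ≥0 → E'} (hf : IsStepPath f)
    (hg : IsStepPath g) (t : ℝ≥0) :
    leftLim (fun t => (f t, g t)) t = (leftLim f t, leftLim g t) := by
  rcases eq_zero_or_pos t with rfl | ht
  · simp only [leftLim_zero]
  · exact leftLim_eq_of_eventually ht
      (((hf.left t).and (hg.left t)).mono fun s hs => by rw [hs.1, hs.2])

lemma IsStepPath.pi [T2Space E] {ι : Type*} [Finite ι] {f : ι → ℝ≥0 → E}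
    (hf : ∀ i, IsStepPath (f i)) :
    IsStepPath fun t i => f i t :=
  .of_exists (fun t => (eventually_all.2 fun i => (hf i).right t).mono
      fun _ hs => funext fun i => hs i)
    fun t _ => ⟨fun i => leftLim (f i) t, (eventually_all.2 fun i => (hf i).left t).mono
      fun _ hs => funext fun i => hs i⟩

lemma IsStepPath.leftLim_pi [T2Space E] {ι : Type*} [Finite ι] {f : ι → ℝ≥0 → E}
    (hf : ∀ i, IsStepPath (f i)) (t : ℝ≥0) :
    leftLim (fun t i => f i t) t = fun i => leftLim (f i) t := by
  rcases eq_zero_or_pos t with rfl | ht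
  · simp only [leftLim_zero]
  · exact leftLim_eq_of_eventually ht
      ((eventually_all.2 fun i => (hf i).left t).mono fun s hs => funext fun i => hs i)

lemma IsStepPath.const [T2Space E] (c : E) : IsStepPath fun _ => c :=
  .of_exists (fun _ => Eventually.of_forall fun _ => rfl)
    fun _ _ => ⟨c, Eventually.of_forall fun _ => rfl⟩

/-- A property that holds at time `0` and survives all jumps of a step path holds for ever. -/
lemma IsStepPath.induction {f : ℝ≥0 → E} (hf : IsStepPath f) (p : E → Prop) (h0 : p (f 0))
    (hstep : ∀ s, 0 < s → p (leftLim f s) → p (f s)) (t : ℝ≥0) : p (f t) := by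
  by_contra ht
  set B : Set ℝ≥0 := {s | ¬ p (f s)} with hB
  have hne : B.Nonempty := ⟨t, ht⟩
  have hbdd : BddBelow B := OrderBot.bddBelow B
  set τ := sInf B with hτ
  have hlt : ∀ s < τ, p (f s) := fun s hs => by
    by_contra h
    exact absurd (csInf_le hbdd h) (not_le.2 hs)
  have hτp : p (f τ) := by
    rcases eq_zero_or_pos τ with h | h
    · rwa [h]
    · apply hstep τ h
      have := nhdsLT_neBot_of_pos h
      obtain ⟨s, hs, hs'⟩ := ((hf.left τ).and self_mem_nhdsWithin).exists
      rw [← hs]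
      exact hlt s hs'
  -- The path equals f τ on (τ, u), while the infimum property puts a bad time b in [τ, u).
  obtain ⟨u, hu, hu'⟩ := (mem_nhdsGT_iff_exists_Ioo_subset).1 (hf.right τ)
  obtain ⟨b, hbB, hb⟩ := exists_lt_of_csInf_lt hne (show sInf B < u from hu)
  have hτb : τ ≤ b := csInf_le hbdd hbB
  rcases hτb.eq_or_lt with h | h
  · exact hbB (h ▸ hτp)
  · have := hu' ⟨h, hb⟩
    simp only [Set.mem_ofPred_eq] at this
    exact hbB (this ▸ hτp)

/-- Two step paths with the same starting point and the same jumps coincide. -/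
lemma IsStepPath.eq_of_jumps [T2Space E] {f g : ℝ≥0 → E} (hf : IsStepPath f) (hg : IsStepPath g)
    (h0 : f 0 = g 0) (h : ∀ s, 0 < s → leftLim f s = leftLim g s → f s = g s) (t : ℝ≥0) :
    f t = g t := by
  refine (hf.prodMk hg).induction (fun x => x.1 = x.2) h0 (fun s hs hl => ?_) t
  rw [hf.leftLim_prodMk hg] at hl
  exact h s hs hl

end StepPath

/-! ### Path integrals against a counting path -/

section CountingPath

variable {N : ℝ≥0 → ℕ}

lemma IsCountingPath.isStepPath (hN : IsCountingPath N) : IsStepPath N := by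
  refine ⟨fun t => ?_, fun t => ?_⟩
  · have h := (hN.rightCont t).mono (Set.Ioi_subset_Ici_self)
    have h' : Tendsto N (𝓝[>] t) (pure (N t)) := by
      rw [← nhds_discrete]; exact h
    exact tendsto_pure.1 h'
  · have h' : Tendsto N (𝓝[<] t) (pure (leftLim N t)) := by
      rw [← nhds_discrete]; exact hN.mono.tendsto_leftLim t
    exact tendsto_pure.1 h'

lemma IsCountingPath.leftLim_le (hN : IsCountingPath N) (s : ℝ≥0) : leftLim N s ≤ N s :=
  hN.mono.leftLim_le le_rfl

/-- N is injective on its jump times, since N s ≤ N(s'-) < N s' for a jump time s' > s, and its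
values up to t are at most N t. -/
lemma IsCountingPath.finite_jumps (hN : IsCountingPath N) (t : ℝ≥0) :
    {s | s ≤ t ∧ leftLim N s ≠ N s}.Finite := by
  refine Set.Finite.of_injOn (f := N) (t := Set.Iic (N t)) (fun s hs => hN.mono hs.1) ?_
    (Set.finite_Iic _)
  have key : ∀ s s', leftLim N s' ≠ N s' → s < s' → N s ≠ N s' := fun s s' h hlt => by
    have h1 := hN.mono.le_leftLim hlt
    have h2 := hN.leftLim_le s'
    omega
  intro s hs s' hs' h
  rcases lt_trichotomy s s' with hlt | rfl | hlt
  · exact absurd h (key s s' hs'.2 hlt)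
  · rfl
  · exact absurd h.symm (key s' s hs.2 hlt)

lemma IsCountingPath.finite_support (hN : IsCountingPath N) (h : ℝ≥0 → ℝ) {S : Set ℝ≥0}
    {t : ℝ≥0} (hS : S ⊆ Set.Iic t) :
    (S ∩ support fun s => h s * ((N s : ℝ) - ((leftLim N s : ℕ) : ℝ))).Finite := by
  refine (hN.finite_jumps t).subset fun s hs => ⟨hS hs.1, fun h' => hs.2 ?_⟩
  simp [h']

/-- One finite set J serves all integrands at once, so linearity and monotonicity of the integral
become those of finite sums. -/
lemma IsCountingPath.exists_pathIntegral_eq_sum (hN : IsCountingPath N) (t : ℝ≥0) :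
    ∃ J : Finset ℝ≥0, (∀ s ∈ J, s ∈ Set.Ioc 0 t) ∧ ∀ h, pathIntegral h N t =
      ∑ s ∈ J, h s * ((N s : ℝ) - ((leftLim N s : ℕ) : ℝ)) := by
  have hfin : (Set.Ioc 0 t ∩ {s | s ≤ t ∧ leftLim N s ≠ N s}).Finite :=
    (hN.finite_jumps t).subset Set.inter_subset_right
  refine ⟨hfin.toFinset, fun s hs => ((hfin.mem_toFinset).1 hs).1, fun h => ?_⟩
  unfold pathIntegral
  rw [finsum_mem_eq_sum_of_inter_support_eq]
  ext s
  simp only [Set.mem_inter_iff, Set.mem_Ioc, mem_support, Set.Finite.coe_toFinset,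
    Set.mem_ofPred_eq]
  constructor
  · rintro ⟨hs, hne⟩
    exact ⟨⟨hs, hs.2, fun h' => hne (by simp [h'])⟩, hne⟩
  · rintro ⟨⟨hs, -⟩, hne⟩
    exact ⟨hs, hne⟩

lemma pathIntegral_zero_right (h : ℝ≥0 → ℝ) (N : ℝ≥0 → ℕ) : pathIntegral h N 0 = 0 := by
  simp [pathIntegral]

lemma IsCountingPath.pathIntegral_sub (hN : IsCountingPath N) (h h' : ℝ≥0 → ℝ) (t : ℝ≥0) :
    pathIntegral (fun s => h s - h' s) N t = pathIntegral h N t - pathIntegral h' N t := by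
  obtain ⟨J, -, hJ⟩ := hN.exists_pathIntegral_eq_sum t
  simp only [hJ, sub_mul, Finset.sum_sub_distrib]

lemma IsCountingPath.pathIntegral_mul_left (hN : IsCountingPath N) (c : ℝ) (h : ℝ≥0 → ℝ)
    (t : ℝ≥0) : pathIntegral (fun s => c * h s) N t = c * pathIntegral h N t := by
  obtain ⟨J, -, hJ⟩ := hN.exists_pathIntegral_eq_sum t
  simp only [hJ, Finset.mul_sum, mul_assoc]

lemma IsCountingPath.pathIntegral_finset_sum (hN : IsCountingPath N) {ι : Type*} (I : Finset ι)
    (h : ι → ℝ≥0 → ℝ) (t : ℝ≥0) :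
    pathIntegral (fun s => ∑ i ∈ I, h i s) N t = ∑ i ∈ I, pathIntegral (h i) N t := by
  obtain ⟨J, -, hJ⟩ := hN.exists_pathIntegral_eq_sum t
  simp only [hJ, Finset.sum_mul]
  exact Finset.sum_comm

lemma IsCountingPath.jump_nonneg (hN : IsCountingPath N) (s : ℝ≥0) :
    0 ≤ (N s : ℝ) - ((leftLim N s : ℕ) : ℝ) :=
  sub_nonneg.2 (by exact_mod_cast hN.leftLim_le s)

lemma IsCountingPath.jump_eq_one {N : ℝ≥0 → ℕ} (hN : IsCountingPath N)
    {s : ℝ≥0} (hs : leftLim N s ≠ N s) : (N s : ℝ) - (leftLim N s : ℕ) = 1 := by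
  have h1 := hN.unitJump s
  have h2 := hN.leftLim_le s
  have : N s = leftLim N s + 1 := by omega
  rw [this]
  push_cast
  ring

lemma IsCountingPath.pathIntegral_mono (hN : IsCountingPath N) {h h' : ℝ≥0 → ℝ}
    (hle : ∀ s, h s ≤ h' s) (t : ℝ≥0) : pathIntegral h N t ≤ pathIntegral h' N t := by
  obtain ⟨J, -, hJ⟩ := hN.exists_pathIntegral_eq_sum t
  simp only [hJ]
  exact Finset.sum_le_sum fun s _ => mul_le_mul_of_nonneg_right (hle s) (hN.jump_nonneg s)

lemma IsCountingPath.pathIntegral_nonneg (hN : IsCountingPath N) {h : ℝ≥0 → ℝ}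
    (hle : ∀ s, 0 ≤ h s) (t : ℝ≥0) : 0 ≤ pathIntegral h N t := by
  obtain ⟨J, -, hJ⟩ := hN.exists_pathIntegral_eq_sum t
  simp only [hJ]
  exact Finset.sum_nonneg fun s _ => mul_nonneg (hle s) (hN.jump_nonneg s)

lemma pathIntegral_eq_of_no_jumps {u v : ℝ≥0} (huv : u ≤ v) (h : ℝ≥0 → ℝ)
    (hJ : ∀ r ∈ Set.Ioc u v, leftLim N r = N r) : pathIntegral h N v = pathIntegral h N u := by
  unfold pathIntegral
  refine finsum_mem_inter_support_eq _ _ _ ?_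
  ext r
  simp only [Set.mem_inter_iff, Set.mem_Ioc, mem_support]
  constructor
  · rintro ⟨hr, hne⟩
    refine ⟨⟨hr.1, ?_⟩, hne⟩
    by_contra hur
    exact hne (by simp [hJ r ⟨not_le.1 hur, hr.2⟩])
  · rintro ⟨hr, hne⟩
    exact ⟨⟨hr.1, hr.2.trans huv⟩, hne⟩

lemma IsCountingPath.pathIntegral_eq_add_jump (hN : IsCountingPath N) {u s : ℝ≥0} (hus : u < s)
    (h : ℝ≥0 → ℝ) (hJ : ∀ r ∈ Set.Ioo u s, leftLim N r = N r) :
    pathIntegral h N s =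
      pathIntegral h N u + h s * ((N s : ℝ) - ((leftLim N s : ℕ) : ℝ)) := by
  unfold pathIntegral
  rw [add_comm, ← finsum_mem_insert' _ (by simp [hus])
    (hN.finite_support h (t := u) fun r hr => hr.2)]
  refine finsum_mem_inter_support_eq _ _ _ ?_
  ext r
  simp only [Set.mem_inter_iff, Set.mem_Ioc, mem_support, Set.mem_insert_iff]
  constructor
  · rintro ⟨hr, hne⟩
    refine ⟨?_, hne⟩
    by_contra! hcon
    have hur : u < r := not_le.1 fun h' => absurd (hcon.2 hr.1) (not_lt.2 h')
    exact hne (by simp [hJ r ⟨hur, lt_of_le_of_ne hr.2 hcon.1⟩])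
  · rintro ⟨rfl | hr, hne⟩
    · exact ⟨⟨pos_of_gt hus, le_rfl⟩, hne⟩
    · exact ⟨⟨hr.1, hr.2.trans hus.le⟩, hne⟩

lemma IsStepPath.leftLim_eq_of_eqOn_Ioo {E : Type*} [TopologicalSpace E] [T2Space E]
    {f : ℝ≥0 → E} {a b r : ℝ≥0} {y : E} (h : ∀ s ∈ Set.Ioo a b, f s = y)
    (hr : r ∈ Set.Ioo a b) : leftLim f r = f r := by
  rw [h r hr]
  refine leftLim_eq_of_eventually (pos_of_gt hr.1) ?_
  filter_upwards [Ioo_mem_nhdsLT hr.1] with s hs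
  exact h s ⟨hs.1, hs.2.trans hr.2⟩

lemma IsCountingPath.eventually_pathIntegral_left (hN : IsCountingPath N) (h : ℝ≥0 → ℝ)
    {s : ℝ≥0} (hs : 0 < s) : ∀ᶠ u in 𝓝[<] s, pathIntegral h N u =
      pathIntegral h N s - h s * ((N s : ℝ) - ((leftLim N s : ℕ) : ℝ)) := by
  obtain ⟨a, ha, ha'⟩ := (mem_nhdsLT_iff_exists_Ioo_subset' hs).1 (hN.isStepPath.left s)
  filter_upwards [Ioo_mem_nhdsLT ha] with u hu
  rw [hN.pathIntegral_eq_add_jump hu.2 h fun r hr =>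
    IsStepPath.leftLim_eq_of_eqOn_Ioo ha' ⟨hu.1.trans hr.1, hr.2⟩]
  ring

/-- Nothing is asked of h: the integral is constant wherever N is. -/
lemma IsCountingPath.isStepPath_pathIntegral (hN : IsCountingPath N) (h : ℝ≥0 → ℝ) :
    IsStepPath (pathIntegral h N) := by
  refine .of_exists (fun t => ?_) fun t ht => ⟨_, hN.eventually_pathIntegral_left h ht⟩
  obtain ⟨b, hb, hb'⟩ := mem_nhdsGT_iff_exists_Ioo_subset.1 (hN.isStepPath.right t)
  filter_upwards [Ioo_mem_nhdsGT hb] with u hu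
  exact pathIntegral_eq_of_no_jumps hu.1.le h fun r hr =>
    IsStepPath.leftLim_eq_of_eqOn_Ioo hb' ⟨hr.1, hr.2.trans_lt hu.2⟩

lemma IsCountingPath.leftLim_pathIntegral (hN : IsCountingPath N) (h : ℝ≥0 → ℝ)
    {s : ℝ≥0} (hs : 0 < s) : leftLim (pathIntegral h N) s =
      pathIntegral h N s - h s * ((N s : ℝ) - ((leftLim N s : ℕ) : ℝ)) :=
  leftLim_eq_of_eventually hs (hN.eventually_pathIntegral_left h hs)

lemma IsCountingPath.pathIntegral_one (hN : IsCountingPath N) (t : ℝ≥0) :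
    pathIntegral (fun _ => 1) N t = N t := by
  refine (hN.isStepPath_pathIntegral _).eq_of_jumps (hN.isStepPath.comp (Nat.cast : ℕ → ℝ))
    (by simp [pathIntegral_zero_right, hN.zero]) (fun s hs h => ?_) t
  rw [hN.leftLim_pathIntegral _ hs, hN.isStepPath.leftLim_comp] at h
  linarith

lemma IsCountingPath.pathIntegral_indicator_Ioc (hN : IsCountingPath N) {a b t : ℝ≥0}
    (hab : a ≤ b) (hbt : b ≤ t) :
    pathIntegral ((Set.Ioc a b).indicator fun _ => 1) N t = N b - N a := by
  have h1 : pathIntegral (fun _ => 1) N b = pathIntegral (fun _ => 1) N a +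
      pathIntegral ((Set.Ioc a b).indicator fun _ => 1) N t := by
    have hun : Set.Ioc 0 b = Set.Ioc 0 a ∪ Set.Ioc a b :=
      (Set.Ioc_union_Ioc_eq_Ioc zero_le hab).symm
    have hdisj : Disjoint (Set.Ioc 0 a) (Set.Ioc a b) :=
      Set.disjoint_left.2 fun r hr hr' => absurd hr.2 (not_le.2 hr'.1)
    unfold pathIntegral
    rw [hun, finsum_mem_union' hdisj (hN.finite_support _ (t := a) fun r hr => hr.2)
      (hN.finite_support _ (t := b) fun r hr => hr.2)]
    congr 1
    rw [finsum_mem_congr rfl (g := fun s => (Set.Ioc a b).indicator (fun _ => (1 : ℝ)) s *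
      ((N s : ℝ) - ((leftLim N s : ℕ) : ℝ))) (fun s hs => by simp [Set.indicator_of_mem hs])]
    refine finsum_mem_inter_support_eq _ _ _ ?_
    ext r
    simp only [Set.mem_inter_iff, mem_support]
    constructor
    · rintro ⟨hr, hne⟩
      exact ⟨⟨pos_of_gt hr.1, hr.2.trans hbt⟩, hne⟩
    · rintro ⟨-, hne⟩
      refine ⟨?_, hne⟩
      by_contra hr
      exact hne (by simp [Set.indicator_of_notMem hr])
  rw [hN.pathIntegral_one, hN.pathIntegral_one] at h1
  linarith

end CountingPath

/-! ### Grid sums and Riemann sums -/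

/-- The `k`-th point of the grid that divides `[0, t]` into `m` intervals of equal length. -/
noncomputable def gridPoint (t : ℝ≥0) (m k : ℕ) : ℝ≥0 := t * (k / m)

section Grid

variable {t : ℝ≥0} {m : ℕ}

lemma gridPoint_zero (t : ℝ≥0) (m : ℕ) : gridPoint t m 0 = 0 := by simp [gridPoint]

lemma gridPoint_self (t : ℝ≥0) (hm : m ≠ 0) : gridPoint t m m = t := by
  have : (m : ℝ≥0) ≠ 0 := by exact_mod_cast hm
  simp [gridPoint, div_self this]

lemma gridPoint_mono (t : ℝ≥0) (m : ℕ) : Monotone (gridPoint t m) := fun k l h => by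
  unfold gridPoint
  gcongr

lemma gridPoint_le (t : ℝ≥0) {k : ℕ} (hk : k ≤ m) : gridPoint t m k ≤ t := by
  rcases eq_or_ne m 0 with rfl | hm
  · simp [gridPoint]
  · exact (gridPoint_mono t m hk).trans_eq (gridPoint_self t hm)

lemma gridPoint_succ (t : ℝ≥0) (m k : ℕ) :
    gridPoint t m (k + 1) = gridPoint t m k + t / m := by
  simp only [gridPoint, Nat.cast_add, Nat.cast_one, add_div, mul_add, mul_one_div]

lemma tendsto_mesh (t : ℝ≥0) : Tendsto (fun m : ℕ => t / (m : ℝ≥0)) atTop (𝓝 0) :=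
  tendsto_const_div_atTop_nhds_zero_nat t

/-- Each indicator is a difference of two consecutive values of I{s ≤ grid point}, and the sum
telescopes. -/
lemma sum_indicator_grid {s : ℝ≥0} (hm : m ≠ 0) (hs : s ∈ Set.Ioc 0 t) :
    ∑ k ∈ Finset.range m, (Set.Ioc (gridPoint t m k) (gridPoint t m (k + 1))).indicator
      (fun _ => (1 : ℝ)) s = 1 := by
  have h : ∀ k, (Set.Ioc (gridPoint t m k) (gridPoint t m (k + 1))).indicator
      (fun _ => (1 : ℝ)) s = (if s ≤ gridPoint t m (k + 1) then 1 else 0) -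
        (if s ≤ gridPoint t m k then 1 else 0) := fun k => by
    have := gridPoint_mono t m (Nat.le_succ k)
    simp only [Set.indicator, Set.mem_Ioc]
    by_cases h1 : s ≤ gridPoint t m k
    · simp [h1, h1.trans this]
    · by_cases h2 : s ≤ gridPoint t m (k + 1) <;> simp [h1, h2]
  simp only [h]
  rw [Finset.sum_range_sub (fun k => if s ≤ gridPoint t m k then (1 : ℝ) else 0),
    gridPoint_self t hm, gridPoint_zero]
  simp [hs.1.ne', hs.2]

/-- The grid sums of `x` over the interval that contains `s` are close to any `c` to which the
relevant values of `x` are close. -/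
lemma abs_sum_grid_sub_le {s : ℝ≥0} (hm : m ≠ 0) (hs : s ∈ Set.Ioc 0 t) (x : ℕ → ℝ) (c ε : ℝ)
    (h : ∀ k, s ∈ Set.Ioc (gridPoint t m k) (gridPoint t m (k + 1)) → |x k - c| ≤ ε) :
    |∑ k ∈ Finset.range m, x k * (Set.Ioc (gridPoint t m k) (gridPoint t m (k + 1))).indicator
      (fun _ => (1 : ℝ)) s - c| ≤ ε := by
  have hone := sum_indicator_grid hm hs
  have : ∑ k ∈ Finset.range m, x k *
      (Set.Ioc (gridPoint t m k) (gridPoint t m (k + 1))).indicator (fun _ => (1 : ℝ)) s - c =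
      ∑ k ∈ Finset.range m, (x k - c) *
      (Set.Ioc (gridPoint t m k) (gridPoint t m (k + 1))).indicator (fun _ => (1 : ℝ)) s := by
    simp only [sub_mul, Finset.sum_sub_distrib, ← Finset.mul_sum, hone, mul_one]
  rw [this]
  calc _ ≤ ∑ k ∈ Finset.range m, |(x k - c) *
        (Set.Ioc (gridPoint t m k) (gridPoint t m (k + 1))).indicator (fun _ => (1 : ℝ)) s| :=
        Finset.abs_sum_le_sum_abs _ _
    _ ≤ ∑ k ∈ Finset.range m, ε *
        (Set.Ioc (gridPoint t m k) (gridPoint t m (k + 1))).indicator (fun _ => (1 : ℝ)) s := by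
        refine Finset.sum_le_sum fun k _ => ?_
        by_cases hk : s ∈ Set.Ioc (gridPoint t m k) (gridPoint t m (k + 1))
        · simpa [Set.indicator_of_mem hk] using h k hk
        · simp [Set.indicator_of_notMem hk]
    _ = ε := by rw [← Finset.mul_sum, hone, mul_one]

/-- Left-point grid sums of a step path converge to its left limits. -/
lemma IsStepPath.tendsto_sum_grid {X : ℝ≥0 → ℝ} (hX : IsStepPath X) {s : ℝ≥0}
    (hs : s ∈ Set.Ioc 0 t) :
    Tendsto (fun m : ℕ => ∑ k ∈ Finset.range m, X (gridPoint t m k) *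
      (Set.Ioc (gridPoint t m k) (gridPoint t m (k + 1))).indicator (fun _ => (1 : ℝ)) s)
      atTop (𝓝 (leftLim X s)) := by
  obtain ⟨a, ha, ha'⟩ := (mem_nhdsLT_iff_exists_Ioo_subset' hs.1).1 (hX.left s)
  -- Once the mesh is below s - a, the cell that contains s has its left endpoint in (a, s), where X
  -- equals its left limit at s.
  have hmesh : ∀ᶠ m : ℕ in atTop, t / (m : ℝ≥0) < s - a :=
    (tendsto_mesh t).eventually_lt_const (tsub_pos_of_lt ha)
  refine tendsto_const_nhds.congr' ?_
  filter_upwards [hmesh, eventually_ne_atTop 0] with m hm hm0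
  have := abs_sum_grid_sub_le hm0 hs (fun k => X (gridPoint t m k)) (leftLim X s) 0
    fun k hk => by
      have hak : a < gridPoint t m k := by
        have h2 := hk.2
        rw [gridPoint_succ] at h2
        have h3 : a + t / m < s := by rw [add_comm]; exact lt_tsub_iff_right.1 hm
        exact lt_of_add_lt_add_right (h3.trans_le h2)
      have h4 : X (gridPoint t m k) = leftLim X s := ha' ⟨hak, hk.1⟩
      simp [h4]
  linarith [abs_nonpos_iff.1 this]

lemma IsCountingPath.pathIntegral_grid {N : ℝ≥0 → ℕ} (hN : IsCountingPath N) (x : ℕ → ℝ) :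
    pathIntegral (fun s => ∑ k ∈ Finset.range m, x k *
      (Set.Ioc (gridPoint t m k) (gridPoint t m (k + 1))).indicator (fun _ => (1 : ℝ)) s) N t =
    ∑ k ∈ Finset.range m, x k *
      ((N (gridPoint t m (k + 1)) : ℝ) - N (gridPoint t m k)) := by
  rw [hN.pathIntegral_finset_sum]
  refine Finset.sum_congr rfl fun k hk => ?_
  rw [hN.pathIntegral_mul_left, hN.pathIntegral_indicator_Ioc (gridPoint_mono t m (Nat.le_succ k))
    (gridPoint_le t (Finset.mem_range.1 hk))]

/-- Riemann sums approximate the integral of a left-continuous integrand. -/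
lemma IsCountingPath.tendsto_riemannSum {N : ℝ≥0 → ℕ} (hN : IsCountingPath N) {X : ℝ≥0 → ℝ}
    (hX : IsStepPath X) (t : ℝ≥0) :
    Tendsto (fun m : ℕ => ∑ k ∈ Finset.range m, X (gridPoint t m k) *
      ((N (gridPoint t m (k + 1)) : ℝ) - N (gridPoint t m k))) atTop
      (𝓝 (pathIntegral (leftLim X) N t)) := by
  simp only [← hN.pathIntegral_grid]
  obtain ⟨J, hJ, hJ'⟩ := hN.exists_pathIntegral_eq_sum t
  simp only [hJ']
  exact tendsto_finsetSum _ fun s hs => (hX.tendsto_sum_grid (hJ s hs)).mul_const _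

/-- Right-point grid sums of a right-continuous function converge to it. -/
lemma tendsto_sum_grid_of_continuousWithinAt {g : ℝ≥0 → ℝ} {s : ℝ≥0}
    (hg : ContinuousWithinAt g (Set.Ici s) s) (hs : s ∈ Set.Ioc 0 t) :
    Tendsto (fun m : ℕ => ∑ k ∈ Finset.range m, g (gridPoint t m (k + 1)) *
      (Set.Ioc (gridPoint t m k) (gridPoint t m (k + 1))).indicator (fun _ => (1 : ℝ)) s)
      atTop (𝓝 (g s)) := by
  rw [Metric.tendsto_nhds]
  intro ε hε
  obtain ⟨δ, hδ, hδ'⟩ := Metric.continuousWithinAt_iff.1 hg (ε / 2) (half_pos hε)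
  have hmesh : ∀ᶠ m : ℕ in atTop, t / (m : ℝ≥0) < δ.toNNReal :=
    (tendsto_mesh t).eventually_lt_const (Real.toNNReal_pos.2 hδ)
  filter_upwards [hmesh, eventually_ne_atTop 0] with m hm hm0
  refine lt_of_le_of_lt ?_ (half_lt_self hε)
  refine abs_sum_grid_sub_le hm0 hs (fun k => g (gridPoint t m (k + 1))) (g s) (ε / 2)
    fun k hk => (hδ' hk.2 ?_).le
  rw [NNReal.dist_eq, abs_lt]
  have h1 := hk.1
  have h2 := hk.2
  rw [gridPoint_succ] at h2 ⊢
  have hm' : ((t / m : ℝ≥0) : ℝ) < δ := by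
    have := NNReal.coe_lt_coe.2 hm
    rwa [Real.coe_toNNReal _ hδ.le] at this
  have h1' := NNReal.coe_lt_coe.2 h1
  have h2' := NNReal.coe_le_coe.2 h2
  rw [NNReal.coe_add] at h2' ⊢
  constructor <;> linarith

/-- Left-point Riemann sums of a bounded right-continuous function. -/
lemma tendsto_riemannSum_integral {g : ℝ≥0 → ℝ}
    (hg : ∀ s, ContinuousWithinAt g (Set.Ici s) s) {C : ℝ} (hC : ∀ s, |g s| ≤ C) (t : ℝ≥0) :
    Tendsto (fun m : ℕ => ∑ k ∈ Finset.range m, g (gridPoint t m k) * (t / m : ℝ)) atTop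
      (𝓝 (∫ s in (0 : ℝ)..t, g s.toNNReal)) := by
  -- Right endpoints are used here because g is only right-continuous: the right end of the cell of
  -- s approaches s from the right.
  set G : ℕ → ℝ → ℝ := fun m s => ∑ k ∈ Finset.range m, g (gridPoint t m (k + 1)) *
      (Set.Ioc (gridPoint t m k : ℝ) (gridPoint t m (k + 1))).indicator (fun _ => (1 : ℝ)) s
    with hG
  have hind : ∀ (m k : ℕ) (s : ℝ), 0 < s →
      (Set.Ioc (gridPoint t m k : ℝ) (gridPoint t m (k + 1))).indicator (fun _ => (1 : ℝ)) s =
      (Set.Ioc (gridPoint t m k) (gridPoint t m (k + 1))).indicator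
        (fun _ => (1 : ℝ)) s.toNNReal := fun m k s hs => by
    have h1 : (s.toNNReal : ℝ) = s := Real.coe_toNNReal _ hs.le
    have h2 : s ∈ Set.Ioc (gridPoint t m k : ℝ) (gridPoint t m (k + 1)) ↔
        s.toNNReal ∈ Set.Ioc (gridPoint t m k) (gridPoint t m (k + 1)) := by
      simp only [Set.mem_Ioc, ← NNReal.coe_lt_coe, ← NNReal.coe_le_coe, h1]
    simp only [Set.indicator, h2]
  have hmem : ∀ s : ℝ, s ∈ Set.uIoc (0 : ℝ) t → 0 < s ∧ s.toNNReal ∈ Set.Ioc 0 t := by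
    intro s hs
    rw [Set.uIoc_of_le t.coe_nonneg] at hs
    exact ⟨hs.1, Real.toNNReal_pos.2 hs.1, Real.toNNReal_le_iff_le_coe.2 hs.2⟩
  have hmeas : ∀ m, Measurable (G m) := fun m =>
    Finset.measurable_fun_sum _ fun k _ =>
      (measurable_const.indicator measurableSet_Ioc).const_mul _
  have hlim : Tendsto (fun m => ∫ s in (0 : ℝ)..t, G m s) atTop
      (𝓝 (∫ s in (0 : ℝ)..t, g s.toNNReal)) := by
    refine intervalIntegral.tendsto_integral_filter_of_dominated_convergence (fun _ => C + C)
      (Eventually.of_forall fun m => (hmeas m).aestronglyMeasurable) ?_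
      intervalIntegrable_const ?_
    · filter_upwards [eventually_ne_atTop 0] with m hm
      refine Eventually.of_forall fun s hs => ?_
      obtain ⟨hs0, hs1⟩ := hmem s hs
      simp only [hG, hind m _ s hs0]
      have := abs_sum_grid_sub_le hm hs1 (fun k => g (gridPoint t m (k + 1))) 0 C
        fun k _ => by simpa using hC _
      rw [sub_zero] at this
      exact this.trans (by linarith [(abs_nonneg _).trans (hC 0)])
    · refine Eventually.of_forall fun s hs => ?_
      obtain ⟨hs0, hs1⟩ := hmem s hs
      simp only [hG, hind _ _ s hs0]
      exact tendsto_sum_grid_of_continuousWithinAt (hg _) hs1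
  have hint : ∀ m, ∫ s in (0 : ℝ)..t, G m s =
      ∑ k ∈ Finset.range m, g (gridPoint t m (k + 1)) * (t / m : ℝ) := fun m => by
    have hii : ∀ k, IntegrableOn ((Set.Ioc (gridPoint t m k : ℝ)
        (gridPoint t m (k + 1))).indicator fun _ => (1 : ℝ)) (Set.Ioc (0 : ℝ) t) := fun k =>
      (integrable_const 1).indicator measurableSet_Ioc
    rw [intervalIntegral.integral_of_le t.coe_nonneg, integral_finsetSum _ fun k _ => (hii k).const_mul _]
    refine Finset.sum_congr rfl fun k hk => ?_
    rw [integral_const_mul, setIntegral_indicator measurableSet_Ioc]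
    congr 1
    have hsub : Set.Ioc (0 : ℝ) t ∩ Set.Ioc (gridPoint t m k : ℝ) (gridPoint t m (k + 1)) =
        Set.Ioc (gridPoint t m k : ℝ) (gridPoint t m (k + 1)) := by
      refine Set.inter_eq_right.2 (Set.Ioc_subset_Ioc (gridPoint t m k).coe_nonneg ?_)
      exact NNReal.coe_le_coe.2 (gridPoint_le t (Finset.mem_range.1 hk))
    rw [hsub, setIntegral_const, gridPoint_succ]
    have : 0 ≤ (t / m : ℝ) := div_nonneg t.coe_nonneg (Nat.cast_nonneg m)
    simp [Measure.real, this]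
  -- Passing from right to left endpoints changes the sum by (g 0 - g t) t/m, by telescoping.
  have hdiff : Tendsto (fun m : ℕ => (g 0 - g t) * (t / m : ℝ)) atTop (𝓝 0) := by
    simpa using (tendsto_const_div_atTop_nhds_zero_nat (t : ℝ)).const_mul (g 0 - g t)
  have := hlim.add hdiff
  rw [add_zero] at this
  refine this.congr' ?_
  filter_upwards [eventually_ne_atTop 0] with m hm
  rw [hint, ← Finset.sum_mul, ← Finset.sum_mul, ← add_mul]
  congr 1
  have h1 := Finset.sum_range_sub (fun k => g (gridPoint t m k)) m
  rw [gridPoint_self t hm, gridPoint_zero, Finset.sum_sub_distrib] at h1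
  linarith

end Grid

/-! ### The mean of the Poisson law -/

section PoissonMean

open Nat in
-- The term at k = 0 vanishes, and k r^k / k! = r · r^(k-1) / (k-1)! reduces the rest to the total
-- mass.
lemma hasSum_mean_poissonMeasure (r : ℝ≥0) :
    HasSum (fun k : ℕ => Real.exp (-r) * r ^ k / (k)! * (k : ℝ)) r := by
  rw [← hasSum_nat_add_iff' 1]
  have h := (hasSum_one_poissonMeasure r).mul_left (r : ℝ)
  simp only [mul_one, Finset.range_one, Finset.sum_singleton, Nat.cast_zero, mul_zero,
    sub_zero] at h ⊢
  refine h.congr_fun fun k => ?_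
  rw [Nat.factorial_succ]
  have : (k ! : ℝ) ≠ 0 := by positivity
  push_cast
  field_simp
  ring

lemma integrable_cast_poissonMeasure (r : ℝ≥0) :
    Integrable (fun k : ℕ => (k : ℝ)) (poissonMeasure r) := by
  rw [integrable_poissonMeasure_iff]
  simpa using (hasSum_mean_poissonMeasure r).summable

lemma integral_cast_poissonMeasure (r : ℝ≥0) :
    ∫ k : ℕ, (k : ℝ) ∂(poissonMeasure r) = r := by
  rw [integral_poissonMeasure]
  simpa using (hasSum_mean_poissonMeasure r).tsum_eq

end PoissonMean

/-! ### Point processes, the compensator formula, common jumps -/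

section CountingProcesses

variable {Ω : Type*} [mΩ : MeasurableSpace Ω] {P : Measure Ω}
  {F : Filtration ℝ≥0 mΩ} {N M : ℝ≥0 → Ω → ℕ} {μ : ℝ≥0}

lemma IsPointProcess.measurable (hN : IsPointProcess F P N) (t : ℝ≥0) : Measurable (N t) :=
  (hN.adapted t).mono (F.le t) le_rfl

lemma IsPointProcess.measurable_cast (hN : IsPointProcess F P N) (t : ℝ≥0) :
    Measurable fun ω => (N t ω : ℝ) :=
  measurable_from_nat.comp (hN.measurable t)

/-- The Poisson law is stated for truncated subtraction in ℕ; monotone paths make it a true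
difference. -/
lemma IsPointProcess.cast_sub_ae (hN : IsPointProcess F P N) {s t : ℝ≥0} (hst : s ≤ t) :
    (fun ω => ((N t ω - N s ω : ℕ) : ℝ)) =ᵐ[P] fun ω => (N t ω : ℝ) - N s ω := by
  filter_upwards [hN.path] with ω hω
  exact Nat.cast_sub (hω.mono hst)

lemma IsPointProcess.measurable_tsub (hN : IsPointProcess F P N) (s t : ℝ≥0) :
    Measurable fun ω => N t ω - N s ω :=
  (hN.measurable t).sub (hN.measurable s)

lemma IsPoissonProcess.ae_isCountingPath (hN : IsPoissonProcess F P μ N) :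
    ∀ᵐ ω ∂P, IsCountingPath fun t => N t ω :=
  hN.isPointProcess.path

lemma IsPoissonProcess.integrable_tsub (hN : IsPoissonProcess F P μ N) {s t : ℝ≥0}
    (hst : s ≤ t) : Integrable (fun ω => ((N t ω - N s ω : ℕ) : ℝ)) P := by
  have h := integrable_cast_poissonMeasure (μ * (t - s))
  rw [← hN.law s t hst] at h
  exact h.comp_measurable (hN.isPointProcess.measurable_tsub s t)

lemma IsPoissonProcess.integral_tsub (hN : IsPoissonProcess F P μ N) {s t : ℝ≥0}
    (hst : s ≤ t) : ∫ ω, ((N t ω - N s ω : ℕ) : ℝ) ∂P = μ * (t - s : ℝ) := by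
  have h := integral_cast_poissonMeasure (μ * (t - s))
  rw [← hN.law s t hst, integral_map (hN.isPointProcess.measurable_tsub s t).aemeasurable
    (Measurable.of_discrete).aestronglyMeasurable] at h
  rw [h, NNReal.coe_mul, NNReal.coe_sub hst]

lemma IsPoissonProcess.integrable (hN : IsPoissonProcess F P μ N) (t : ℝ≥0) :
    Integrable (fun ω => (N t ω : ℝ)) P := by
  refine (hN.integrable_tsub (zero_le (a := t))).congr ?_
  filter_upwards [hN.ae_isCountingPath] with ω hω
  simp [hω.zero]

/-- The increment of a Poisson process after time `s` is uncorrelated with the past. -/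
lemma IsPoissonProcess.integral_mul_increment (hN : IsPoissonProcess F P μ N) {s t : ℝ≥0}
    (hst : s ≤ t) {Y : Ω → ℝ} (hY : Measurable[F s] Y) :
    ∫ ω, Y ω * ((N t ω : ℝ) - N s ω) ∂P = (∫ ω, Y ω ∂P) * (μ * (t - s : ℝ)) := by
  have hind : IndepFun Y (fun ω => N t ω - N s ω) P := by
    rw [IndepFun_iff_Indep]
    exact indep_of_indep_of_le_left (hN.indep s t hst).symm (measurable_iff_comap_le.1 hY)
  have hind' : IndepFun Y (fun ω => ((N t ω - N s ω : ℕ) : ℝ)) P :=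
    hind.comp measurable_id (measurable_from_nat (f := fun k : ℕ => (k : ℝ)))
  rw [← hN.integral_tsub hst, ← hind'.integral_fun_mul_eq_mul_integral
    (hY.mono (F.le s) le_rfl).aestronglyMeasurable (hN.integrable_tsub hst).1]
  refine integral_congr_ae ?_
  filter_upwards [hN.isPointProcess.cast_sub_ae hst] with ω hω
  simp only [hω]

/-- The integral is an almost sure limit of Riemann sums, which are visibly measurable. -/
lemma IsPointProcess.aestronglyMeasurable_pathIntegral (hN : IsPointProcess F P N)
    {Y : ℝ≥0 → Ω → ℝ} (hY : ∀ t, Measurable (Y t))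
    (hstep : ∀ᵐ ω ∂P, IsStepPath fun t => Y t ω) (t : ℝ≥0) :
    AEStronglyMeasurable
      (fun ω => pathIntegral (leftLim fun s => Y s ω) (fun s => N s ω) t) P := by
  refine aestronglyMeasurable_of_tendsto_ae atTop (f := fun (m : ℕ) ω =>
    ∑ k ∈ Finset.range m, Y (gridPoint t m k) ω *
      ((N (gridPoint t m (k + 1)) ω : ℝ) - N (gridPoint t m k) ω)) (fun m => ?_) ?_
  · exact (Finset.measurable_fun_sum _ fun k _ => (hY _).mul
      ((hN.measurable_cast _).sub (hN.measurable_cast _))).aestronglyMeasurable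
  · filter_upwards [hN.path, hstep] with ω hω hω'
    exact hω.tendsto_riemannSum hω' t

/-- The bound does not depend on m, so for a Poisson process N t is an integrable dominating
function. -/
lemma IsCountingPath.abs_riemannSum_le {N : ℝ≥0 → ℕ} (hN : IsCountingPath N) {x : ℕ → ℝ}
    (hx : ∀ k, |x k| ≤ 1) (t : ℝ≥0) (m : ℕ) :
    |∑ k ∈ Finset.range m, x k *
      ((N (gridPoint t m (k + 1)) : ℝ) - N (gridPoint t m k))| ≤ N t := by
  have hinc : ∀ k, (0 : ℝ) ≤ (N (gridPoint t m (k + 1)) : ℝ) - N (gridPoint t m k) :=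
    fun k => sub_nonneg.2 (by exact_mod_cast hN.mono (gridPoint_mono t m (Nat.le_succ k)))
  calc _ ≤ ∑ k ∈ Finset.range m, |x k *
        ((N (gridPoint t m (k + 1)) : ℝ) - N (gridPoint t m k))| :=
        Finset.abs_sum_le_sum_abs _ _
    _ ≤ ∑ k ∈ Finset.range m, ((N (gridPoint t m (k + 1)) : ℝ) - N (gridPoint t m k)) := by
        refine Finset.sum_le_sum fun k _ => ?_
        rw [abs_mul, abs_of_nonneg (hinc k)]
        exact mul_le_of_le_one_left (hinc k) (hx k)
    _ = N (gridPoint t m m) - N (gridPoint t m 0) :=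
        Finset.sum_range_sub (fun k => (N (gridPoint t m k) : ℝ)) m
    _ ≤ N t := by
        have : (N (gridPoint t m m) : ℝ) ≤ N t := by exact_mod_cast hN.mono (gridPoint_le t le_rfl)
        have h0 : (0 : ℝ) ≤ N (gridPoint t m 0) := Nat.cast_nonneg _
        linarith

lemma continuousWithinAt_integral [IsProbabilityMeasure P] {Y : ℝ≥0 → Ω → ℝ}
    (hY : ∀ t, Measurable (Y t)) (hbdd : ∀ t ω, |Y t ω| ≤ 1)
    (hstep : ∀ᵐ ω ∂P, IsStepPath fun t => Y t ω) (s : ℝ≥0) :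
    ContinuousWithinAt (fun s => ∫ ω, Y s ω ∂P) (Set.Ici s) s := by
  refine tendsto_integral_filter_of_dominated_convergence (fun _ => 1)
    (Eventually.of_forall fun t => (hY t).aestronglyMeasurable)
    (Eventually.of_forall fun t => Eventually.of_forall (hbdd t)) (integrable_const _) ?_
  filter_upwards [hstep] with ω hω
  have h : ContinuousWithinAt (fun t => Y t ω) (Set.Ioi s) s :=
    tendsto_const_nhds.congr' ((hω.right s).mono fun u hu => hu.symm)
  exact continuousWithinAt_Ioi_iff_Ici.1 h

/-- The compensator formula for integrals of bounded left limits against a Poisson process. -/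
lemma IsPoissonProcess.integral_pathIntegral [IsProbabilityMeasure P]
    (hN : IsPoissonProcess F P μ N)
    {Y : ℝ≥0 → Ω → ℝ} (hY : ∀ t, Measurable[F t] (Y t)) (hbdd : ∀ t ω, |Y t ω| ≤ 1)
    (hstep : ∀ᵐ ω ∂P, IsStepPath fun t => Y t ω) (t : ℝ≥0) :
    Integrable (fun ω => pathIntegral (leftLim fun s => Y s ω) (fun s => N s ω) t) P ∧
    ∫ ω, pathIntegral (leftLim fun s => Y s ω) (fun s => N s ω) t ∂P =
      μ * ∫ s in (0 : ℝ)..t, ∫ ω, Y s.toNNReal ω ∂P := by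
  have hY' : ∀ t, Measurable (Y t) := fun t => (hY t).mono (F.le t) le_rfl
  have hpath := hN.ae_isCountingPath
  have hbound : ∀ m : ℕ, ∀ᵐ ω ∂P, ‖∑ k ∈ Finset.range m, Y (gridPoint t m k) ω *
      ((N (gridPoint t m (k + 1)) ω : ℝ) - N (gridPoint t m k) ω)‖ ≤ N t ω := fun m => by
    filter_upwards [hpath] with ω hω
    exact hω.abs_riemannSum_le (fun k => hbdd (gridPoint t m k) ω) t m
  have hmeas : ∀ (m k : ℕ), Measurable fun ω => Y (gridPoint t m k) ω *
      ((N (gridPoint t m (k + 1)) ω : ℝ) - N (gridPoint t m k) ω) := fun m k =>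
    (hY' _).mul ((hN.isPointProcess.measurable_cast _).sub (hN.isPointProcess.measurable_cast _))
  have hlim : ∀ᵐ ω ∂P, Tendsto (fun m : ℕ => ∑ k ∈ Finset.range m, Y (gridPoint t m k) ω *
      ((N (gridPoint t m (k + 1)) ω : ℝ) - N (gridPoint t m k) ω)) atTop
      (𝓝 (pathIntegral (leftLim fun s => Y s ω) (fun s => N s ω) t)) := by
    filter_upwards [hpath, hstep] with ω hω hω'
    exact hω.tendsto_riemannSum hω' t
  constructor
  · refine (hN.integrable t).mono' (hN.isPointProcess.aestronglyMeasurable_pathIntegral hY' hstep t)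
      ?_
    filter_upwards [hlim, ae_all_iff.2 hbound] with ω h1 h2
    exact le_of_tendsto h1.norm (Eventually.of_forall h2)
  · have h1 := tendsto_integral_of_dominated_convergence (fun ω => (N t ω : ℝ))
      (fun m => (Finset.measurable_fun_sum _ fun k _ => hmeas m k).aestronglyMeasurable)
      (hN.integrable t) hbound hlim
    have hC : ∀ s, |∫ ω, Y s ω ∂P| ≤ 1 := fun s => by
      simpa using norm_integral_le_of_norm_le_const (μ := P) (f := Y s) (C := 1)
        (Eventually.of_forall fun ω => hbdd s ω)
    have h2 := (tendsto_riemannSum_integral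
      (continuousWithinAt_integral hY' hbdd hstep) hC t).const_mul (μ : ℝ)
    -- The expected Riemann sums of the path integral are exactly the Riemann sums of μ E Y, since Y
    -- at a left grid point is measurable with respect to the past and the next increment is
    -- independent of it.
    refine tendsto_nhds_unique h1 (h2.congr fun m => ?_)
    rw [integral_finsetSum, Finset.mul_sum]
    · refine Finset.sum_congr rfl fun k _ => ?_
      rw [hN.integral_mul_increment (gridPoint_mono t m (Nat.le_succ k)) (hY _), gridPoint_succ]
      push_cast
      ring
    · intro k _
      have hi : Integrable (fun ω => (N (gridPoint t m (k + 1)) ω : ℝ) -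
        N (gridPoint t m k) ω) P := (hN.integrable _).sub (hN.integrable _)
      exact hi.bdd_mul (hY' _).aestronglyMeasurable (Eventually.of_forall (hbdd _))

/-- Markov's inequality at level 1. -/
lemma IsPoissonProcess.measure_increment_le [IsProbabilityMeasure P]
    (hN : IsPoissonProcess F P μ N) {s t : ℝ≥0}
    (hst : s ≤ t) : P {ω | 1 ≤ N t ω - N s ω} ≤ μ * (t - s : ℝ≥0) := by
  have h := mul_meas_ge_le_integral_of_nonneg
    (Eventually.of_forall fun ω => Nat.cast_nonneg (α := ℝ) (N t ω - N s ω))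
    (hN.integrable_tsub hst) 1
  rw [hN.integral_tsub hst, one_mul] at h
  simp only [Nat.one_le_cast] at h
  rw [← NNReal.coe_sub hst, ← NNReal.coe_mul] at h
  have h2 := ENNReal.ofReal_le_ofReal h
  rwa [ofReal_measureReal, ENNReal.ofReal_coe_nnreal, ENNReal.coe_mul] at h2

lemma exists_grid_interval {s t : ℝ≥0} {m : ℕ} (hm : m ≠ 0) (hs : s ∈ Set.Ioc 0 t) :
    ∃ k < m, s ∈ Set.Ioc (gridPoint t m k) (gridPoint t m (k + 1)) := by
  by_contra! h
  have h1 := sum_indicator_grid hm hs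
  rw [Finset.sum_eq_zero fun k hk => Set.indicator_of_notMem (h k (Finset.mem_range.1 hk)) _] at h1
  exact zero_ne_one h1

lemma IsCountingPath.one_le_increment {N : ℝ≥0 → ℕ} (hN : IsCountingPath N) {a b s : ℝ≥0}
    (hs : s ∈ Set.Ioc a b) (hjump : leftLim N s ≠ N s) : 1 ≤ N b - N a := by
  have h1 := hN.mono.le_leftLim hs.1
  have h2 := hN.leftLim_le s
  have h3 := hN.mono hs.2
  omega

/-- Independent Poisson processes have no common jumps. -/
lemma IsPoissonProcess.jumpsDisjoint [IsProbabilityMeasure P] (hN : IsPoissonProcess F P μ N)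
    (hM : IsPoissonProcess F P μ M)
    (hind : IndepFun (fun ω t => N t ω) (fun ω t => M t ω) P) : JumpsDisjoint P N M := by
  have key : ∀ T : ℕ, ∀ᵐ ω ∂P, ∀ s ∈ Set.Ioc (0 : ℝ≥0) T,
      leftLim (fun s => N s ω) s = N s ω ∨ leftLim (fun s => M s ω) s = M s ω := by
    intro T
    -- For every m, a common jump in (0, T] forces both increments over some cell to be at least 1.
    -- By independence a cell does so with probability at most (μT/m)², hence some cell does with
    -- probability at most (μT)²/m.
    set S : ℕ → ℕ → Set Ω := fun m k =>
      {ω | 1 ≤ N (gridPoint T m (k + 1)) ω - N (gridPoint T m k) ω} ∩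
      {ω | 1 ≤ M (gridPoint T m (k + 1)) ω - M (gridPoint T m k) ω} with hS
    have hSk : ∀ m k, P (S m k) ≤ ((μ * (T / m)) ^ 2 : ℝ≥0) := fun m k => by
      have hle := gridPoint_mono (T : ℝ≥0) m (Nat.le_succ k)
      have hsub : gridPoint (T : ℝ≥0) m (k + 1) - gridPoint T m k = T / m := by
        rw [gridPoint_succ, add_tsub_cancel_left]
      have hφ : Measurable fun x : ℝ≥0 → ℕ =>
          x (gridPoint T m (k + 1)) - x (gridPoint T m k) :=
        (measurable_pi_apply _).sub (measurable_pi_apply _)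
      have h1 := (hind.comp hφ hφ).measure_inter_preimage_eq_mul (Set.Ici 1) (Set.Ici 1)
        measurableSet_Ici measurableSet_Ici
      have h2 := hN.measure_increment_le hle
      have h3 := hM.measure_increment_le hle
      rw [Nat.succ_eq_add_one, hsub, ← ENNReal.coe_mul] at h2 h3
      rw [sq, ENNReal.coe_mul]
      exact h1.trans_le (mul_le_mul' h2 h3)
    have hsum : ∀ m : ℕ, m ≠ 0 → P (⋃ k ∈ Finset.range m, S m k) ≤
        ((μ * T) ^ 2 / m : ℝ≥0) := fun m hm => by
      refine (measure_biUnion_finset_le _ _).trans ((Finset.sum_le_sum fun k _ => hSk m k).trans ?_)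
      rw [Finset.sum_const, Finset.card_range, nsmul_eq_mul]
      refine le_of_eq ?_
      rw [← ENNReal.coe_natCast, ← ENNReal.coe_mul]
      congr 1
      have : (m : ℝ≥0) ≠ 0 := by exact_mod_cast hm
      field_simp
    have hzero : P (⋂ m ∈ Set.Ici 1, ⋃ k ∈ Finset.range m, S m k) = 0 := by
      have hlim : Tendsto (fun m : ℕ => (((μ * T) ^ 2 / m : ℝ≥0) : ENNReal)) atTop (𝓝 0) := by
        rw [← ENNReal.coe_zero]
        exact ENNReal.tendsto_coe.2 (tendsto_mesh ((μ * T) ^ 2))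
      refine le_antisymm (ge_of_tendsto hlim ?_) (zero_le)
      filter_upwards [eventually_ge_atTop 1] with m hm
      exact (measure_mono (Set.biInter_subset_of_mem hm)).trans (hsum m (by omega))
    have hae : ∀ᵐ ω ∂P, ω ∉ ⋂ m ∈ Set.Ici 1, ⋃ k ∈ Finset.range m, S m k :=
      measure_eq_zero_iff_ae_notMem.1 hzero
    filter_upwards [hae, hN.ae_isCountingPath, hM.ae_isCountingPath] with ω hω hNω hMω s hs
    by_contra! hcon
    apply hω
    simp only [Set.mem_iInter, Set.mem_iUnion]
    intro m hm
    obtain ⟨k, hk, hsk⟩ := exists_grid_interval (m := m) (by simp at hm; omega) hs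
    exact ⟨k, Finset.mem_range.2 hk, hNω.one_le_increment hsk hcon.1,
      hMω.one_le_increment hsk hcon.2⟩
  filter_upwards [ae_all_iff.2 key] with ω hω s
  rcases eq_zero_or_pos s with rfl | hs
  · exact .inl (leftLim_zero _)
  · obtain ⟨T, hT⟩ := exists_nat_ge s
    exact hω T s ⟨hs, hT⟩

end CountingProcesses

/-! ### Sums and differences of real step paths -/

section StepAlgebra

variable {f g : ℝ≥0 → ℝ}

lemma IsStepPath.add (hf : IsStepPath f) (hg : IsStepPath g) : IsStepPath fun t => f t + g t :=
  (hf.prodMk hg).comp fun x => x.1 + x.2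

lemma IsStepPath.sub (hf : IsStepPath f) (hg : IsStepPath g) : IsStepPath fun t => f t - g t :=
  (hf.prodMk hg).comp fun x => x.1 - x.2

lemma IsStepPath.leftLim_add (hf : IsStepPath f) (hg : IsStepPath g) (s : ℝ≥0) :
    leftLim (fun t => f t + g t) s = leftLim f s + leftLim g s := by
  rw [(hf.prodMk hg).leftLim_comp fun x => x.1 + x.2, hf.leftLim_prodMk hg]

lemma IsStepPath.leftLim_sub (hf : IsStepPath f) (hg : IsStepPath g) (s : ℝ≥0) :
    leftLim (fun t => f t - g t) s = leftLim f s - leftLim g s := by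
  rw [(hf.prodMk hg).leftLim_comp fun x => x.1 - x.2, hf.leftLim_prodMk hg]

lemma IsStepPath.finset_sum {ι : Type*} [Fintype ι] {f : ι → ℝ≥0 → ℝ}
    (hf : ∀ i, IsStepPath (f i)) : IsStepPath fun t => ∑ i, f i t :=
  (IsStepPath.pi hf).comp fun x => ∑ i, x i

lemma IsStepPath.leftLim_finset_sum {ι : Type*} [Fintype ι] {f : ι → ℝ≥0 → ℝ}
    (hf : ∀ i, IsStepPath (f i)) (s : ℝ≥0) :
    leftLim (fun t => ∑ i, f i t) s = ∑ i, leftLim (f i) s := by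
  rw [(IsStepPath.pi hf).leftLim_comp fun x => ∑ i, x i, IsStepPath.leftLim_pi hf]

lemma IsStepPath.of_cast {q : ℝ≥0 → ℕ} (hq : IsStepPath fun t => (q t : ℝ)) : IsStepPath q := by
  simpa using hq.comp Nat.floor

end StepAlgebra

/-! ### Dynamics of the retrial system along a path -/

/-- The state of the system (busy servers, customers in orbit) after an arrival. -/
def afterArrival (n : ℕ) (x : ℕ × ℕ) : ℕ × ℕ :=
  if x.1 ≠ n then (x.1 + 1, x.2) else if x.2 ≠ 1 then (x.1, x.2 + 1) else x

/-- The state of the system after a retrial. -/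
def afterRetrial (n : ℕ) (x : ℕ × ℕ) : ℕ × ℕ :=
  if x.1 ≠ n ∧ x.2 = 1 then (x.1 + 1, x.2 - 1) else x

/-- The state of the system after a jump of the `l`-th service process. -/
def afterService (l : ℕ) (x : ℕ × ℕ) : ℕ × ℕ :=
  if l + 1 ≤ x.1 then (x.1 - 1, x.2) else x

/-- The path properties of a retrial system that hold with probability one. -/
structure IsRetrialPath (n : ℕ) (A D : ℝ≥0 → ℕ) (π : Fin n → ℝ≥0 → ℕ) (q₁ q₂ q₃ : ℝ≥0 → ℕ) :
    Prop where
  arrivals : IsCountingPath A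
  retrials : IsCountingPath D
  services : ∀ l, IsCountingPath (π l)
  disjoint_arrivals_retrials : ∀ t, leftLim A t = A t ∨ leftLim D t = D t
  disjoint_arrivals_services : ∀ l t, leftLim A t = A t ∨ leftLim (π l) t = π l t
  disjoint_retrials_services : ∀ l t, leftLim D t = D t ∨ leftLim (π l) t = π l t
  disjoint_services : ∀ l m, l ≠ m → ∀ t, leftLim (π l) t = π l t ∨ leftLim (π m) t = π m t
  total : ∀ t, (q₁ t : ℝ) + q₂ t + q₃ t = A t - ∑ l : Fin n,
    pathIntegral (fun s => if (l : ℕ) + 1 ≤ leftLim q₁ s then 1 else 0) (π l) t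
  orbit : ∀ t, (q₂ t : ℝ) + q₃ t =
    pathIntegral (fun s => if leftLim q₁ s = n then 1 else 0) A t -
      pathIntegral (fun s => if leftLim q₁ s ≠ n ∧ leftLim q₂ s = 1 then 1 else 0) D t
  losses : ∀ t, (q₃ t : ℝ) =
    pathIntegral (fun s => if leftLim q₁ s = n ∧ leftLim q₂ s = 1 then 1 else 0) A t

namespace IsRetrialPath

variable {n : ℕ} {A D : ℝ≥0 → ℕ} {π : Fin n → ℝ≥0 → ℕ} {q₁ q₂ q₃ : ℝ≥0 → ℕ}

/-- The integrand involves left limits of paths not yet known to be regular, which is harmless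
because any integrand yields a step path. Solving the orbit equation and then the total one extends
this to `q₂` and `q₁`. -/
lemma isStepPath_losses (h : IsRetrialPath n A D π q₁ q₂ q₃) : IsStepPath q₃ := by
  apply IsStepPath.of_cast
  simp only [h.losses]
  exact h.arrivals.isStepPath_pathIntegral _

lemma isStepPath_orbit (h : IsRetrialPath n A D π q₁ q₂ q₃) : IsStepPath q₂ := by
  apply IsStepPath.of_cast
  have : (fun t => (q₂ t : ℝ)) = fun t =>
      (pathIntegral (fun s => if leftLim q₁ s = n then 1 else 0) A t -
        pathIntegral (fun s => if leftLim q₁ s ≠ n ∧ leftLim q₂ s = 1 then 1 else 0) D t) -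
        (q₃ t : ℝ) := by
    funext t
    rw [← h.orbit t, add_sub_cancel_right]
  rw [this]
  exact ((h.arrivals.isStepPath_pathIntegral _).sub (h.retrials.isStepPath_pathIntegral _)).sub
    (h.isStepPath_losses.comp Nat.cast)

lemma isStepPath_busy (h : IsRetrialPath n A D π q₁ q₂ q₃) : IsStepPath q₁ := by
  apply IsStepPath.of_cast
  have : (fun t => (q₁ t : ℝ)) = fun t => ((A t : ℝ) - ∑ l : Fin n,
      pathIntegral (fun s => if (l : ℕ) + 1 ≤ leftLim q₁ s then 1 else 0) (π l) t) -
        ((q₂ t : ℝ) + q₃ t) := by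
    funext t
    rw [← h.total t]
    ring
  rw [this]
  exact ((h.arrivals.isStepPath.comp Nat.cast).sub (IsStepPath.finset_sum fun l =>
    (h.services l).isStepPath_pathIntegral _)).sub
    ((h.isStepPath_orbit.comp Nat.cast).add (h.isStepPath_losses.comp Nat.cast))

lemma isStepPath_state (h : IsRetrialPath n A D π q₁ q₂ q₃) :
    IsStepPath fun t => (q₁ t, q₂ t) :=
  h.isStepPath_busy.prodMk h.isStepPath_orbit

lemma leftLim_state (h : IsRetrialPath n A D π q₁ q₂ q₃) (s : ℝ≥0) :
    leftLim (fun t => (q₁ t, q₂ t)) s = (leftLim q₁ s, leftLim q₂ s) :=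
  h.isStepPath_busy.leftLim_prodMk h.isStepPath_orbit s

lemma losses_jump (h : IsRetrialPath n A D π q₁ q₂ q₃) {s : ℝ≥0} (hs : 0 < s) :
    (q₃ s : ℝ) - (leftLim q₃ s : ℕ) =
      (if leftLim q₁ s = n ∧ leftLim q₂ s = 1 then 1 else 0) *
        ((A s : ℝ) - (leftLim A s : ℕ)) := by
  rw [← h.isStepPath_losses.leftLim_comp (Nat.cast : ℕ → ℝ)]
  simp only [h.losses]
  rw [h.arrivals.leftLim_pathIntegral _ hs]
  ring

lemma orbit_jump (h : IsRetrialPath n A D π q₁ q₂ q₃) {s : ℝ≥0} (hs : 0 < s) :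
    ((q₂ s : ℝ) - (leftLim q₂ s : ℕ)) + ((q₃ s : ℝ) - (leftLim q₃ s : ℕ)) =
      (if leftLim q₁ s = n then 1 else 0) * ((A s : ℝ) - (leftLim A s : ℕ)) -
      (if leftLim q₁ s ≠ n ∧ leftLim q₂ s = 1 then 1 else 0) *
        ((D s : ℝ) - (leftLim D s : ℕ)) := by
  have h2 := h.isStepPath_orbit.comp (Nat.cast : ℕ → ℝ)
  have h3 := h.isStepPath_losses.comp (Nat.cast : ℕ → ℝ)
  have e : leftLim (fun t => (q₂ t : ℝ) + q₃ t) s =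
      ((leftLim q₂ s : ℕ) : ℝ) + ((leftLim q₃ s : ℕ) : ℝ) := by
    rw [h2.leftLim_add h3, h.isStepPath_orbit.leftLim_comp, h.isStepPath_losses.leftLim_comp]
  have e' := h.orbit s
  simp only [h.orbit] at e
  rw [(h.arrivals.isStepPath_pathIntegral _).leftLim_sub (h.retrials.isStepPath_pathIntegral _),
    h.arrivals.leftLim_pathIntegral _ hs, h.retrials.leftLim_pathIntegral _ hs] at e
  linarith

lemma total_jump (h : IsRetrialPath n A D π q₁ q₂ q₃) {s : ℝ≥0} (hs : 0 < s) :
    ((q₁ s : ℝ) - (leftLim q₁ s : ℕ)) + ((q₂ s : ℝ) - (leftLim q₂ s : ℕ)) +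
      ((q₃ s : ℝ) - (leftLim q₃ s : ℕ)) = ((A s : ℝ) - (leftLim A s : ℕ)) -
      ∑ l : Fin n, (if (l : ℕ) + 1 ≤ leftLim q₁ s then 1 else 0) *
        ((π l s : ℝ) - (leftLim (π l) s : ℕ)) := by
  have h1 := h.isStepPath_busy.comp (Nat.cast : ℕ → ℝ)
  have h2 := h.isStepPath_orbit.comp (Nat.cast : ℕ → ℝ)
  have h3 := h.isStepPath_losses.comp (Nat.cast : ℕ → ℝ)
  have e : leftLim (fun t => (q₁ t : ℝ) + q₂ t + q₃ t) s =
      ((leftLim q₁ s : ℕ) : ℝ) + ((leftLim q₂ s : ℕ) : ℝ) + ((leftLim q₃ s : ℕ) : ℝ) := by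
    rw [(h1.add h2).leftLim_add h3, h1.leftLim_add h2, h.isStepPath_busy.leftLim_comp,
      h.isStepPath_orbit.leftLim_comp, h.isStepPath_losses.leftLim_comp]
  have e' := h.total s
  have hl := fun l : Fin n => (h.services l).isStepPath_pathIntegral
    (fun s => if (l : ℕ) + 1 ≤ leftLim q₁ s then 1 else 0)
  simp only [h.total] at e
  rw [(h.arrivals.isStepPath.comp (Nat.cast : ℕ → ℝ)).leftLim_sub (IsStepPath.finset_sum hl),
    IsStepPath.leftLim_finset_sum hl, h.arrivals.isStepPath.leftLim_comp,
    Finset.sum_congr rfl fun l _ => (h.services l).leftLim_pathIntegral _ hs,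
    Finset.sum_sub_distrib] at e
  linarith

lemma state_eq_of_no_jump (h : IsRetrialPath n A D π q₁ q₂ q₃) {s : ℝ≥0} (hs : 0 < s)
    (hA : leftLim A s = A s) (hD : leftLim D s = D s)
    (hπ : ∀ l, leftLim (π l) s = π l s) :
    (q₁ s, q₂ s) = (leftLim q₁ s, leftLim q₂ s) := by
  have e1 := h.total_jump hs
  have e2 := h.orbit_jump hs
  have e3 := h.losses_jump hs
  simp only [hA, hD, hπ, sub_self, mul_zero, Finset.sum_const_zero] at e1 e2 e3
  ext
  · have : (q₁ s : ℝ) = (leftLim q₁ s : ℕ) := by linarith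
    exact_mod_cast this
  · have : (q₂ s : ℝ) = (leftLim q₂ s : ℕ) := by linarith
    exact_mod_cast this

/-- Nothing else jumps together with A, so the three jump equations become a linear system for the
jumps of `q₁`, `q₂`, `q₃`. -/
lemma state_eq_afterArrival (h : IsRetrialPath n A D π q₁ q₂ q₃) {s : ℝ≥0} (hs : 0 < s)
    (hA : leftLim A s ≠ A s) :
    (q₁ s, q₂ s) = afterArrival n (leftLim q₁ s, leftLim q₂ s) := by
  have hD := (h.disjoint_arrivals_retrials s).resolve_left hA
  have hπ := fun l => (h.disjoint_arrivals_services l s).resolve_left hA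
  have e1 := h.total_jump hs
  have e2 := h.orbit_jump hs
  have e3 := h.losses_jump hs
  simp only [h.arrivals.jump_eq_one hA, hD, hπ, sub_self, mul_zero, Finset.sum_const_zero,
    mul_one] at e1 e2 e3
  unfold afterArrival
  by_cases hn : leftLim q₁ s = n
  · by_cases h1 : leftLim q₂ s = 1
    · simp only [hn, h1, and_self, if_true, ne_eq, not_true_eq_false, if_false] at e1 e2 e3 ⊢
      ext
      · have : (q₁ s : ℝ) = n := by push_cast at *; linarith
        exact_mod_cast this
      · have : (q₂ s : ℝ) = 1 := by push_cast at *; linarith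
        exact_mod_cast this
    · simp only [hn, h1, and_false, if_false, if_true, ne_eq, not_true_eq_false,
        not_false_eq_true] at e1 e2 e3 ⊢
      ext
      · have : (q₁ s : ℝ) = n := by linarith
        exact_mod_cast this
      · have : (q₂ s : ℝ) = (leftLim q₂ s : ℕ) + 1 := by linarith
        exact_mod_cast this
  · simp only [hn, false_and, if_false, if_true, ne_eq, not_false_eq_true] at e1 e2 e3 ⊢
    ext
    · have : (q₁ s : ℝ) = (leftLim q₁ s : ℕ) + 1 := by linarith
      exact_mod_cast this
    · have : (q₂ s : ℝ) = (leftLim q₂ s : ℕ) := by linarith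
      exact_mod_cast this

lemma state_eq_afterRetrial (h : IsRetrialPath n A D π q₁ q₂ q₃) {s : ℝ≥0} (hs : 0 < s)
    (hD : leftLim D s ≠ D s) :
    (q₁ s, q₂ s) = afterRetrial n (leftLim q₁ s, leftLim q₂ s) := by
  have hA := (h.disjoint_arrivals_retrials s).resolve_right hD
  have hπ := fun l => (h.disjoint_retrials_services l s).resolve_left hD
  have e1 := h.total_jump hs
  have e2 := h.orbit_jump hs
  have e3 := h.losses_jump hs
  simp only [h.retrials.jump_eq_one hD, hA, hπ, sub_self, mul_zero, Finset.sum_const_zero,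
    mul_one] at e1 e2 e3
  unfold afterRetrial
  by_cases hn : leftLim q₁ s ≠ n ∧ leftLim q₂ s = 1
  · rw [if_pos hn] at e2 ⊢
    rw [hn.2] at e1 e2 ⊢
    ext
    · have : (q₁ s : ℝ) = (leftLim q₁ s : ℕ) + 1 := by linarith
      exact_mod_cast this
    · have : (q₂ s : ℝ) = 0 := by push_cast at *; linarith
      exact_mod_cast this
  · rw [if_neg hn] at e2 ⊢
    ext
    · have : (q₁ s : ℝ) = (leftLim q₁ s : ℕ) := by linarith
      exact_mod_cast this
    · have : (q₂ s : ℝ) = (leftLim q₂ s : ℕ) := by linarith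
      exact_mod_cast this

lemma state_eq_afterService (h : IsRetrialPath n A D π q₁ q₂ q₃) {s : ℝ≥0} (hs : 0 < s)
    {l : Fin n} (hl : leftLim (π l) s ≠ π l s) :
    (q₁ s, q₂ s) = afterService l (leftLim q₁ s, leftLim q₂ s) := by
  have hA := (h.disjoint_arrivals_services l s).resolve_right hl
  have hD := (h.disjoint_retrials_services l s).resolve_right hl
  have hπ := fun m (hm : m ≠ l) => (h.disjoint_services l m hm.symm s).resolve_left hl
  have e1 := h.total_jump hs
  have e2 := h.orbit_jump hs
  have e3 := h.losses_jump hs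
  rw [Finset.sum_eq_single l (fun m _ hm => by simp [hπ m hm]) (by simp),
    (h.services l).jump_eq_one hl] at e1
  simp only [hA, hD, sub_self, mul_zero, mul_one] at e1 e2 e3
  unfold afterService
  have hq2 : (q₂ s : ℝ) = (leftLim q₂ s : ℕ) := by linarith
  by_cases hn : (l : ℕ) + 1 ≤ leftLim q₁ s
  · simp only [if_pos hn] at e1 ⊢
    ext
    · have : (q₁ s : ℝ) + 1 = (leftLim q₁ s : ℕ) := by linarith
      have h' : q₁ s + 1 = leftLim q₁ s := by exact_mod_cast this
      simp only
      omega
    · exact_mod_cast hq2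
  · simp only [if_neg hn] at e1 ⊢
    ext
    · have : (q₁ s : ℝ) = (leftLim q₁ s : ℕ) := by linarith
      exact_mod_cast this
    · exact_mod_cast hq2

/-- The state stays in `{0, …, n} × {0, 1}`. -/
lemma state_le (h : IsRetrialPath n A D π q₁ q₂ q₃) (t : ℝ≥0) : q₁ t ≤ n ∧ q₂ t ≤ 1 := by
  refine h.isStepPath_state.induction (fun x => x.1 ≤ n ∧ x.2 ≤ 1) ?_ (fun s hs hp => ?_) t
  · have h0 := h.total 0
    simp only [pathIntegral_zero_right, h.arrivals.zero, Finset.sum_const_zero, Nat.cast_zero,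
      sub_zero] at h0
    have h0' : q₁ 0 + q₂ 0 + q₃ 0 = 0 := by exact_mod_cast h0
    simp only
    omega
  · rw [h.leftLim_state] at hp
    by_cases hA : leftLim A s = A s
    · by_cases hD : leftLim D s = D s
      · by_cases hπ : ∀ l, leftLim (π l) s = π l s
        · rw [h.state_eq_of_no_jump hs hA hD hπ]
          exact hp
        · push Not at hπ
          obtain ⟨l, hl⟩ := hπ
          rw [h.state_eq_afterService hs hl]
          unfold afterService
          split_ifs
          · simp only at hp ⊢
            omega
          · exact hp
      · rw [h.state_eq_afterRetrial hs hD]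
        unfold afterRetrial
        split_ifs with h1
        · simp only at hp h1 ⊢
          omega
        · exact hp
    · rw [h.state_eq_afterArrival hs hA]
      unfold afterArrival
      split_ifs with h1 h2
      · simp only [ne_eq] at hp h1 ⊢
        omega
      · simp only [ne_eq, not_not] at hp h1 h2 ⊢
        omega
      · exact hp

lemma leftLim_state_le (h : IsRetrialPath n A D π q₁ q₂ q₃) (s : ℝ≥0) :
    leftLim q₁ s ≤ n ∧ leftLim q₂ s ≤ 1 := by
  rcases eq_zero_or_pos s with rfl | hs
  · simp only [leftLim_zero]
    exact h.state_le 0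
  · have := nhdsLT_neBot_of_pos hs
    obtain ⟨u, hu1, hu2⟩ := ((h.isStepPath_busy.left s).and (h.isStepPath_orbit.left s)).exists
    rw [← hu1, ← hu2]
    exact h.state_le u

/-- The change of a function of the state is the sum of its changes at the jumps. -/
lemma state_balance (h : IsRetrialPath n A D π q₁ q₂ q₃) (φ : ℕ × ℕ → ℝ) (t : ℝ≥0) :
    φ (q₁ t, q₂ t) = φ (q₁ 0, q₂ 0) +
      pathIntegral (fun s => φ (afterArrival n (leftLim q₁ s, leftLim q₂ s)) -
        φ (leftLim q₁ s, leftLim q₂ s)) A t +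
      pathIntegral (fun s => φ (afterRetrial n (leftLim q₁ s, leftLim q₂ s)) -
        φ (leftLim q₁ s, leftLim q₂ s)) D t +
      ∑ l : Fin n, pathIntegral (fun s => φ (afterService l (leftLim q₁ s, leftLim q₂ s)) -
        φ (leftLim q₁ s, leftLim q₂ s)) (π l) t := by
  have sA := h.arrivals.isStepPath_pathIntegral
    (fun s => φ (afterArrival n (leftLim q₁ s, leftLim q₂ s)) - φ (leftLim q₁ s, leftLim q₂ s))
  have sD := h.retrials.isStepPath_pathIntegral
    (fun s => φ (afterRetrial n (leftLim q₁ s, leftLim q₂ s)) - φ (leftLim q₁ s, leftLim q₂ s))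
  have sl := fun l => (h.services l).isStepPath_pathIntegral
    (fun s => φ (afterService l (leftLim q₁ s, leftLim q₂ s)) - φ (leftLim q₁ s, leftLim q₂ s))
  have s0 : IsStepPath fun _ : ℝ≥0 => φ (q₁ 0, q₂ 0) := IsStepPath.const _
  -- Both sides are step paths with the same start; it remains to match their jumps, according to
  -- which driving process jumps.
  refine (h.isStepPath_state.comp φ).eq_of_jumps
    (((s0.add sA).add sD).add (IsStepPath.finset_sum sl)) ?_ (fun s hs hp => ?_) t
  · simp [pathIntegral_zero_right]
  rw [h.isStepPath_state.leftLim_comp, h.leftLim_state,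
    ((s0.add sA).add sD).leftLim_add (IsStepPath.finset_sum sl), (s0.add sA).leftLim_add sD,
    s0.leftLim_add sA, h.arrivals.leftLim_pathIntegral _ hs, h.retrials.leftLim_pathIntegral _ hs,
    IsStepPath.leftLim_finset_sum sl,
    Finset.sum_congr rfl fun l _ => (h.services l).leftLim_pathIntegral _ hs,
    Finset.sum_sub_distrib,
    leftLim_eq_of_eventually hs (y := φ (q₁ 0, q₂ 0)) (Eventually.of_forall fun _ => rfl)] at hp
  by_cases hA : leftLim A s = A s
  · by_cases hD : leftLim D s = D s
    · by_cases hπ : ∀ l, leftLim (π l) s = π l s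
      · simp only [hA, hD, hπ, sub_self, mul_zero, Finset.sum_const_zero] at hp
        rw [h.state_eq_of_no_jump hs hA hD hπ]
        linarith
      · push Not at hπ
        obtain ⟨l, hl⟩ := hπ
        have hπ := fun m (hm : m ≠ l) => (h.disjoint_services l m hm.symm s).resolve_left hl
        rw [Finset.sum_eq_single (f := fun l : Fin n => _ * _) l
          (fun m _ hm => by simp [hπ m hm]) (by simp), (h.services l).jump_eq_one hl] at hp
        simp only [hA, hD, sub_self, mul_zero] at hp
        rw [h.state_eq_afterService hs hl]
        linarith
    · have hπ := fun l => (h.disjoint_retrials_services l s).resolve_left hD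
      simp only [hA, h.retrials.jump_eq_one hD, hπ, sub_self, mul_zero,
        Finset.sum_const_zero] at hp
      rw [h.state_eq_afterRetrial hs hD]
      linarith
  · have hD := (h.disjoint_arrivals_retrials s).resolve_left hA
    have hπ := fun l => (h.disjoint_arrivals_services l s).resolve_left hA
    simp only [hD, h.arrivals.jump_eq_one hA, hπ, sub_self, mul_zero,
      Finset.sum_const_zero] at hp
    rw [h.state_eq_afterArrival hs hA]
    linarith

/-- The number of arrivals that are not lost is bounded by the services. -/
lemma accepted_arrivals_le (h : IsRetrialPath n A D π q₁ q₂ q₃) (t : ℝ≥0) :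
    pathIntegral (fun s => 1 - if leftLim q₁ s = n ∧ leftLim q₂ s = 1 then 1 else 0) A t ≤
      n + 1 + ∑ l, (π l t : ℝ) := by
  -- Accepted arrivals are A - `q₃`, which by the total equation is `q₁` + `q₂` plus the completed
  -- services.
  rw [h.arrivals.pathIntegral_sub, h.arrivals.pathIntegral_one, ← h.losses]
  have h1 := h.total t
  obtain ⟨h2, h3⟩ := h.state_le t
  have h2' : (q₁ t : ℝ) ≤ n := by exact_mod_cast h2
  have h3' : (q₂ t : ℝ) ≤ 1 := by exact_mod_cast h3
  have h4 : ∑ l : Fin n, pathIntegral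
      (fun s => if (l : ℕ) + 1 ≤ leftLim q₁ s then 1 else 0) (π l) t ≤ ∑ l, (π l t : ℝ) := by
    refine Finset.sum_le_sum fun l _ => ?_
    rw [← (h.services l).pathIntegral_one]
    exact (h.services l).pathIntegral_mono (fun s => by split_ifs <;> norm_num) t
  linarith

lemma arrivals_le (h : IsRetrialPath n A D π q₁ q₂ q₃) {i j : ℕ} (hij : (i, j) ≠ (n, 1))
    (t : ℝ≥0) : pathIntegral (preState q₁ q₂ i j) A t ≤ n + 1 + ∑ l, (π l t : ℝ) := by
  refine (h.arrivals.pathIntegral_mono (fun s => ?_) t).trans (h.accepted_arrivals_le t)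
  unfold preState
  by_cases h1 : leftLim q₁ s = n ∧ leftLim q₂ s = 1
  · have h2 : ¬ (leftLim q₁ s = i ∧ leftLim q₂ s = j) := fun h2 =>
      hij (by rw [← h2.1, ← h2.2, h1.1, h1.2])
    simp [if_pos h1, if_neg h2]
  · rw [if_neg h1]
    split_ifs <;> norm_num

/-- Since `q₂` ≥ 0, successful retrials are at most the arrivals that find all servers busy minus
the losses, hence at most the accepted arrivals. -/
lemma retrials_le (h : IsRetrialPath n A D π q₁ q₂ q₃) {i : ℕ} (hi : i < n) (t : ℝ≥0) :
    pathIntegral (preState q₁ q₂ i 1) D t ≤ n + 1 + ∑ l, (π l t : ℝ) := by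
  have h1 : pathIntegral (preState q₁ q₂ i 1) D t ≤ pathIntegral
      (fun s => if leftLim q₁ s ≠ n ∧ leftLim q₂ s = 1 then 1 else 0) D t := by
    refine h.retrials.pathIntegral_mono (fun s => ?_) t
    unfold preState
    by_cases h1 : leftLim q₁ s = i ∧ leftLim q₂ s = 1
    · rw [if_pos h1, if_pos ⟨by omega, h1.2⟩]
    · rw [if_neg h1]
      split_ifs <;> norm_num
  have h2 := h.orbit t
  rw [h.losses] at h2
  have h3 := h.accepted_arrivals_le t
  rw [h.arrivals.pathIntegral_sub] at h3
  have h4 : pathIntegral (fun s => if leftLim q₁ s = n then 1 else 0) A t ≤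
      pathIntegral (fun _ => 1) A t :=
    h.arrivals.pathIntegral_mono (fun s => by split_ifs <;> norm_num) t
  have h5 : (0 : ℝ) ≤ q₂ t := Nat.cast_nonneg _
  linarith

end IsRetrialPath

/-! ### Balance equation of a single state -/

/-- The indicator of the state `(i, j)`. -/
def stateIndicator (i j : ℕ) (x : ℕ × ℕ) : ℝ := if x.1 = i ∧ x.2 = j then 1 else 0

lemma IsCountingPath.pathIntegral_add {N : ℝ≥0 → ℕ} (hN : IsCountingPath N) (h h' : ℝ≥0 → ℝ)
    (t : ℝ≥0) :
    pathIntegral (fun s => h s + h' s) N t = pathIntegral h N t + pathIntegral h' N t := by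
  obtain ⟨J, -, hJ⟩ := hN.exists_pathIntegral_eq_sum t
  simp only [hJ, add_mul, Finset.sum_add_distrib]

/-- This counts the service processes active when k servers are busy and is the source of the factor
iμ. -/
lemma sum_fin_ite_lt {n k : ℕ} (hk : k ≤ n) (c : ℝ) :
    ∑ l : Fin n, (if (l : ℕ) < k then 1 else 0) * c = k * c := by
  rw [← Finset.sum_mul, Fin.sum_univ_eq_sum_range (fun l => if l < k then (1 : ℝ) else 0),
    ← Finset.sum_filter]
  have : Finset.filter (fun l => l < k) (Finset.range n) = Finset.range k := by
    ext l
    simp only [Finset.mem_filter, Finset.mem_range]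
    omega
  simp [this]

section Increments

variable {n i j : ℕ} {x : ℕ × ℕ}

/-- The state (n, 1) is exceptional: an arrival there is lost and causes no outflow, while an
arrival in (n, 0) enters the orbit and gives an extra inflow. The guard 1 ≤ i excludes the truncated
value of i - 1 at i = 0. -/
lemma stateIndicator_afterArrival_sub (hi : i ≤ n) (hx : x.1 ≤ n ∧ x.2 ≤ 1) :
    stateIndicator i j (afterArrival n x) - stateIndicator i j x =
      (if 1 ≤ i then 1 else 0) * stateIndicator (i - 1) j x +
      (if i = n ∧ j = 1 then 1 else 0) * stateIndicator n 0 x -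
      (if i = n ∧ j = 1 then 0 else 1) * stateIndicator i j x := by
  obtain ⟨a, b⟩ := x
  simp only at hx
  unfold stateIndicator afterArrival
  simp only
  by_cases h1 : a = n
  · by_cases h2 : b = 1
    · simp only [h1, h2, ne_eq, not_true_eq_false, if_false]
      grind
    · simp only [h1, h2, ne_eq, not_true_eq_false, if_false, not_false_eq_true, if_true]
      grind
  · simp only [h1, ne_eq, not_false_eq_true, if_true]
    grind

lemma stateIndicator_afterRetrial_sub (hi : i ≤ n) (hj : j ≤ 1) (hx : x.1 ≤ n ∧ x.2 ≤ 1) :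
    stateIndicator i j (afterRetrial n x) - stateIndicator i j x =
      (if 1 ≤ i ∧ j = 0 then 1 else 0) * stateIndicator (i - 1) 1 x -
      (if i < n ∧ j = 1 then 1 else 0) * stateIndicator i 1 x := by
  obtain ⟨a, b⟩ := x
  simp only at hx
  unfold stateIndicator afterRetrial
  simp only
  by_cases h1 : a ≠ n ∧ b = 1
  · rw [if_pos h1]
    grind
  · rw [if_neg h1]
    grind

/-- Process l moves (i + 1, j) to (i, j) when l < i + 1 and empties (i, j) when l < i. The guard i <
n drops the unattainable level n + 1. -/
lemma stateIndicator_afterService_sub {l : ℕ} (hx : x.1 ≤ n ∧ x.2 ≤ 1) :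
    stateIndicator i j (afterService l x) - stateIndicator i j x =
      (if i < n then 1 else 0) * ((if l < i + 1 then 1 else 0) * stateIndicator (i + 1) j x) -
      (if l < i then 1 else 0) * stateIndicator i j x := by
  obtain ⟨a, b⟩ := x
  simp only at hx
  unfold stateIndicator afterService
  simp only
  by_cases h1 : l + 1 ≤ a
  · rw [if_pos h1]
    grind
  · rw [if_neg h1]
    grind

end Increments

/-- The balance equation of the state `(i, j)` along a path. -/
lemma IsRetrialPath.indicator_balance {n : ℕ} {A D : ℝ≥0 → ℕ} {π : Fin n → ℝ≥0 → ℕ}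
    {q₁ q₂ q₃ : ℝ≥0 → ℕ} (h : IsRetrialPath n A D π q₁ q₂ q₃) {i j : ℕ} (hi : i ≤ n)
    (hj : j ≤ 1) (t : ℝ≥0) :
    stateIndicator i j (q₁ t, q₂ t) - stateIndicator i j (q₁ 0, q₂ 0) =
      (if 1 ≤ i then 1 else 0) * pathIntegral (preState q₁ q₂ (i - 1) j) A t +
      (if i = n ∧ j = 1 then 1 else 0) * pathIntegral (preState q₁ q₂ n 0) A t -
      (if i = n ∧ j = 1 then 0 else 1) * pathIntegral (preState q₁ q₂ i j) A t +
      ((if 1 ≤ i ∧ j = 0 then 1 else 0) * pathIntegral (preState q₁ q₂ (i - 1) 1) D t -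
      (if i < n ∧ j = 1 then 1 else 0) * pathIntegral (preState q₁ q₂ i 1) D t) +
      ∑ l : Fin n, ((if i < n then 1 else 0) * ((if (l : ℕ) < i + 1 then 1 else 0) *
        pathIntegral (preState q₁ q₂ (i + 1) j) (π l) t) -
      (if (l : ℕ) < i then 1 else 0) * pathIntegral (preState q₁ q₂ i j) (π l) t) := by
  have hx := h.leftLim_state_le
  have hpre : ∀ i j s, stateIndicator i j (leftLim q₁ s, leftLim q₂ s) = preState q₁ q₂ i j s :=
    fun _ _ _ => rfl
  have hl : ∀ l : Fin n, (fun s => stateIndicator i j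
      (afterService l (leftLim q₁ s, leftLim q₂ s)) -
        stateIndicator i j (leftLim q₁ s, leftLim q₂ s)) = fun s =>
      (if i < n then 1 else 0) * ((if (l : ℕ) < i + 1 then 1 else 0) *
        preState q₁ q₂ (i + 1) j s) - (if (l : ℕ) < i then 1 else 0) * preState q₁ q₂ i j s :=
    fun l => funext fun s => stateIndicator_afterService_sub (hx s)
  rw [h.state_balance (stateIndicator i j) t]
  simp only [hl, fun s => stateIndicator_afterArrival_sub (j := j)
      (x := (leftLim q₁ s, leftLim q₂ s)) hi (hx s),
    fun s => stateIndicator_afterRetrial_sub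
      (x := (leftLim q₁ s, leftLim q₂ s)) hi hj (hx s)]
  simp only [hpre, h.arrivals.pathIntegral_sub, h.arrivals.pathIntegral_add,
    h.arrivals.pathIntegral_mul_left, h.retrials.pathIntegral_sub,
    h.retrials.pathIntegral_mul_left, fun l => (h.services l).pathIntegral_sub,
    fun l => (h.services l).pathIntegral_mul_left]
  ring

lemma integral_balance_terms {Ω ι : Type*} [MeasurableSpace Ω] {P : Measure Ω} [Fintype ι]
    {f₁ f₂ f₃ f₄ f₅ : Ω → ℝ} {g g' : ι → Ω → ℝ} (h₁ : Integrable f₁ P) (h₂ : Integrable f₂ P)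
    (h₃ : Integrable f₃ P) (h₄ : Integrable f₄ P) (h₅ : Integrable f₅ P)
    (hg : ∀ l, Integrable (g l) P) (hg' : ∀ l, Integrable (g' l) P) :
    ∫ ω, (f₁ ω + f₂ ω - f₃ ω + (f₄ ω - f₅ ω) + ∑ l, (g l ω - g' l ω)) ∂P =
      ∫ ω, f₁ ω ∂P + ∫ ω, f₂ ω ∂P - ∫ ω, f₃ ω ∂P + (∫ ω, f₄ ω ∂P - ∫ ω, f₅ ω ∂P) +
        ∑ l, (∫ ω, g l ω ∂P - ∫ ω, g' l ω ∂P) := by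
  have h₁₂ : Integrable (fun ω => f₁ ω + f₂ ω) P := h₁.add h₂
  have h₁₂₃ : Integrable (fun ω => f₁ ω + f₂ ω - f₃ ω) P := h₁₂.sub h₃
  have h₁₅ : Integrable (fun ω => f₁ ω + f₂ ω - f₃ ω + (f₄ ω - f₅ ω)) P :=
    h₁₂₃.add (h₄.sub h₅)
  have h₄₅ : Integrable (fun ω => f₄ ω - f₅ ω) P := h₄.sub h₅
  have hl : ∀ l, Integrable (fun ω => g l ω - g' l ω) P := fun l => (hg l).sub (hg' l)
  rw [integral_add h₁₅ (integrable_finsetSum _ fun l _ => hl l),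
    integral_add h₁₂₃ h₄₅, integral_sub h₁₂ h₃, integral_add h₁ h₂, integral_sub h₄ h₅,
    integral_finsetSum _ fun l _ => hl l,
    Finset.sum_congr rfl fun l _ => integral_sub (hg l) (hg' l)]

/-! ### Expectations for the retrial system -/

section System

variable {Ω : Type*} [mΩ : MeasurableSpace Ω] {P : Measure Ω} [IsProbabilityMeasure P]
  {F : Filtration ℝ≥0 mΩ} {n : ℕ} {μ : ℝ≥0} {A D : ℝ≥0 → Ω → ℕ} {π : Fin n → ℝ≥0 → Ω → ℕ}
  {Q₁ Q₂ Q₃ : ℝ≥0 → Ω → ℕ}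

namespace IsRetrialSystem

lemma ae_isRetrialPath (hQ : IsRetrialSystem n μ F P A D π Q₁ Q₂ Q₃) :
    ∀ᵐ ω ∂P, IsRetrialPath n (fun t => A t ω) (fun t => D t ω) (fun l t => π l t ω)
      (fun t => Q₁ t ω) (fun t => Q₂ t ω) (fun t => Q₃ t ω) := by
  have hππ : ∀ᵐ ω ∂P, ∀ l m, l ≠ m → ∀ t, leftLim (fun s => π l s ω) t = π l t ω ∨
      leftLim (fun s => π m s ω) t = π m t ω := by
    refine ae_all_iff.2 fun l => ae_all_iff.2 fun m => ?_
    by_cases hlm : l = m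
    · exact Eventually.of_forall fun ω h => absurd hlm h
    · filter_upwards [(hQ.services l).jumpsDisjoint (hQ.services m)
        (hQ.services_indep.indepFun hlm)] with ω hω _
      exact hω
  filter_upwards [hQ.arrivals.path, hQ.retrials.path,
    ae_all_iff.2 fun l => (hQ.services l).ae_isCountingPath,
    hQ.disjoint_arrivals_retrials, ae_all_iff.2 hQ.disjoint_arrivals_services,
    ae_all_iff.2 hQ.disjoint_retrials_services, hππ, hQ.total, hQ.orbit, hQ.losses]
    with ω h1 h2 h3 h4 h5 h6 h7 h8 h9 h10
  exact ⟨h1, h2, h3, h4, h5, h6, h7, h8, h9, h10⟩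

omit [IsProbabilityMeasure P] in
lemma measurable_stateIndicator (hQ : IsRetrialSystem n μ F P A D π Q₁ Q₂ Q₃) (i j : ℕ)
    (t : ℝ≥0) : Measurable[F t] fun ω => stateIndicator i j (Q₁ t ω, Q₂ t ω) :=
  (Measurable.of_discrete (f := stateIndicator i j)).comp
    ((hQ.adapted₁ t).prodMk (hQ.adapted₂ t))

omit [IsProbabilityMeasure P] in
lemma integral_stateIndicator (hQ : IsRetrialSystem n μ F P A D π Q₁ Q₂ Q₃) (i j : ℕ)
    (t : ℝ≥0) : ∫ ω, stateIndicator i j (Q₁ t ω, Q₂ t ω) ∂P =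
      P.real {ω | Q₁ t ω = i ∧ Q₂ t ω = j} := by
  have hm : MeasurableSet {ω | Q₁ t ω = i ∧ Q₂ t ω = j} :=
    (((hQ.adapted₁ t).mono (F.le t) le_rfl) (measurableSet_singleton i)).inter
      (((hQ.adapted₂ t).mono (F.le t) le_rfl) (measurableSet_singleton j))
  rw [← integral_indicator_one hm]
  congr 1 with ω
  simp [stateIndicator, Set.indicator]

lemma abs_stateIndicator_le (i j : ℕ) (x : ℕ × ℕ) : |stateIndicator i j x| ≤ 1 := by
  unfold stateIndicator
  split_ifs <;> norm_num

lemma integrable_stateIndicator (hQ : IsRetrialSystem n μ F P A D π Q₁ Q₂ Q₃) (i j : ℕ)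
    (t : ℝ≥0) : Integrable (fun ω => stateIndicator i j (Q₁ t ω, Q₂ t ω)) P :=
  .of_bound ((hQ.measurable_stateIndicator i j t).mono (F.le t) le_rfl).aestronglyMeasurable 1
    (Eventually.of_forall fun _ => abs_stateIndicator_le i j _)

lemma ae_isStepPath (hQ : IsRetrialSystem n μ F P A D π Q₁ Q₂ Q₃) (i j : ℕ) :
    ∀ᵐ ω ∂P, IsStepPath fun t => stateIndicator i j (Q₁ t ω, Q₂ t ω) := by
  filter_upwards [hQ.ae_isRetrialPath] with ω hω
  exact hω.isStepPath_state.comp _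

lemma ae_leftLim_stateIndicator (hQ : IsRetrialSystem n μ F P A D π Q₁ Q₂ Q₃) (i j : ℕ) :
    ∀ᵐ ω ∂P, leftLim (fun t => stateIndicator i j (Q₁ t ω, Q₂ t ω)) =
      preState (fun t => Q₁ t ω) (fun t => Q₂ t ω) i j := by
  filter_upwards [hQ.ae_isRetrialPath] with ω hω
  funext s
  rw [hω.isStepPath_state.leftLim_comp, hω.leftLim_state]
  rfl

lemma aestronglyMeasurable_visits (hQ : IsRetrialSystem n μ F P A D π Q₁ Q₂ Q₃)
    {N : ℝ≥0 → Ω → ℕ} (hN : IsPointProcess F P N) (i j : ℕ) (t : ℝ≥0) :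
    AEStronglyMeasurable (visits Q₁ Q₂ N i j t) P := by
  refine (hN.aestronglyMeasurable_pathIntegral
    (fun t => (hQ.measurable_stateIndicator i j t).mono (F.le t) le_rfl)
    (hQ.ae_isStepPath i j) t).congr ?_
  filter_upwards [hQ.ae_leftLim_stateIndicator i j] with ω hω
  rw [hω]
  rfl

lemma preState_nonneg (q₁ q₂ : ℝ≥0 → ℕ) (i j : ℕ) (s : ℝ≥0) : 0 ≤ preState q₁ q₂ i j s := by
  unfold preState
  split_ifs <;> norm_num

lemma integrable_service_bound (hQ : IsRetrialSystem n μ F P A D π Q₁ Q₂ Q₃) (t : ℝ≥0) :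
    Integrable (fun ω => (n : ℝ) + 1 + ∑ l, (π l t ω : ℝ)) P :=
  (integrable_const _).add (integrable_finsetSum _ fun l _ => (hQ.services l).integrable t)

/-- The dominating variable consists of Poisson counts; integrability of A itself is not available.
-/
lemma integrable_visits_arrivals (hQ : IsRetrialSystem n μ F P A D π Q₁ Q₂ Q₃) {i j : ℕ}
    (hij : (i, j) ≠ (n, 1)) (t : ℝ≥0) : Integrable (visits Q₁ Q₂ A i j t) P := by
  refine (hQ.integrable_service_bound t).mono' (hQ.aestronglyMeasurable_visits hQ.arrivals i j t) ?_
  filter_upwards [hQ.ae_isRetrialPath] with ω hω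
  rw [Real.norm_eq_abs, abs_of_nonneg]
  · exact hω.arrivals_le hij t
  · exact hω.arrivals.pathIntegral_nonneg (preState_nonneg _ _ i j) t

lemma integrable_visits_retrials (hQ : IsRetrialSystem n μ F P A D π Q₁ Q₂ Q₃) {i : ℕ}
    (hi : i < n) (t : ℝ≥0) : Integrable (visits Q₁ Q₂ D i 1 t) P := by
  refine (hQ.integrable_service_bound t).mono' (hQ.aestronglyMeasurable_visits hQ.retrials i 1 t) ?_
  filter_upwards [hQ.ae_isRetrialPath] with ω hω
  rw [Real.norm_eq_abs, abs_of_nonneg]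
  · exact hω.retrials_le hi t
  · exact hω.retrials.pathIntegral_nonneg (preState_nonneg _ _ i 1) t

lemma integrable_visits_services (hQ : IsRetrialSystem n μ F P A D π Q₁ Q₂ Q₃) (l : Fin n)
    (i j : ℕ) (t : ℝ≥0) : Integrable (visits Q₁ Q₂ (π l) i j t) P := by
  refine ((hQ.services l).integral_pathIntegral (hQ.measurable_stateIndicator i j)
    (fun _ _ => abs_stateIndicator_le i j _) (hQ.ae_isStepPath i j) t).1.congr ?_
  filter_upwards [hQ.ae_leftLim_stateIndicator i j] with ω hω
  rw [hω]
  rfl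

lemma integral_visits_services (hQ : IsRetrialSystem n μ F P A D π Q₁ Q₂ Q₃) (l : Fin n)
    (i j : ℕ) (t : ℝ≥0) : ∫ ω, visits Q₁ Q₂ (π l) i j t ω ∂P =
      μ * ∫ s in (0 : ℝ)..t, P.real {ω | Q₁ s.toNNReal ω = i ∧ Q₂ s.toNNReal ω = j} := by
  simp only [← hQ.integral_stateIndicator]
  rw [← ((hQ.services l).integral_pathIntegral (hQ.measurable_stateIndicator i j)
    (fun _ _ => abs_stateIndicator_le i j _) (hQ.ae_isStepPath i j) t).2]
  refine integral_congr_ae ?_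
  filter_upwards [hQ.ae_leftLim_stateIndicator i j] with ω hω
  rw [hω]
  rfl

/-- The balance equation of the state `(i, j)` in the mean, over a finite time horizon. -/
lemma mean_balance (hQ : IsRetrialSystem n μ F P A D π Q₁ Q₂ Q₃) {i j : ℕ} (hi : i ≤ n)
    (hj : j ≤ 1) (t : ℝ≥0) :
    (t : ℝ)⁻¹ * (P.real {ω | Q₁ t ω = i ∧ Q₂ t ω = j} - P.real {ω | Q₁ 0 ω = i ∧ Q₂ 0 ω = j}) =
      (if 1 ≤ i then 1 else 0) * rate P Q₁ Q₂ A (i - 1) j t +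
      (if i = n ∧ j = 1 then 1 else 0) * rate P Q₁ Q₂ A n 0 t -
      (if i = n ∧ j = 1 then 0 else 1) * rate P Q₁ Q₂ A i j t +
      ((if 1 ≤ i ∧ j = 0 then 1 else 0) * rate P Q₁ Q₂ D (i - 1) 1 t -
      (if i < n ∧ j = 1 then 1 else 0) * rate P Q₁ Q₂ D i 1 t) +
      ((if i < n then 1 else 0) * ((i + 1) * μ * freq P Q₁ Q₂ (i + 1) j t) -
      i * μ * freq P Q₁ Q₂ i j t) := by
  have ite_mul_integrable : ∀ (p : Prop) [Decidable p] (f : Ω → ℝ), (p → Integrable f P) →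
      Integrable (fun ω => (if p then (1 : ℝ) else 0) * f ω) P := fun p _ f hf => by
    by_cases hp : p
    · simpa [hp] using hf hp
    · simp [hp]
  have i1 := ite_mul_integrable (1 ≤ i) _ fun h =>
    hQ.integrable_visits_arrivals (i := i - 1) (j := j) (fun h' => by simp at h'; omega) t
  have i2 := ite_mul_integrable (i = n ∧ j = 1) _ fun h =>
    hQ.integrable_visits_arrivals (i := n) (j := 0) (by simp) t
  -- In the state (n, 1) the visits count lost arrivals and may fail to be integrable, but there the
  -- coefficient is 0.
  have i3 : Integrable (fun ω => (if i = n ∧ j = 1 then (0 : ℝ) else 1) *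
      visits Q₁ Q₂ A i j t ω) P := by
    by_cases hp : i = n ∧ j = 1
    · simp [hp]
    · simpa only [if_neg hp, one_mul] using
        hQ.integrable_visits_arrivals (fun h' => hp (by simpa using h')) t
  have i4 := ite_mul_integrable (1 ≤ i ∧ j = 0) _ fun h =>
    hQ.integrable_visits_retrials (i := i - 1) (by omega) t
  have i5 := ite_mul_integrable (i < n ∧ j = 1) _ fun h =>
    hQ.integrable_visits_retrials h.1 t
  have i6 : ∀ l : Fin n, Integrable (fun ω => (if i < n then (1 : ℝ) else 0) *
      ((if (l : ℕ) < i + 1 then (1 : ℝ) else 0) * visits Q₁ Q₂ (π l) (i + 1) j t ω)) P := fun l =>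
    ((hQ.integrable_visits_services l (i + 1) j t).const_mul _).const_mul _
  have i7 : ∀ l : Fin n, Integrable (fun ω => (if (l : ℕ) < i then (1 : ℝ) else 0) *
      visits Q₁ Q₂ (π l) i j t ω) P := fun l =>
    (hQ.integrable_visits_services l i j t).const_mul _
  have key : P.real {ω | Q₁ t ω = i ∧ Q₂ t ω = j} - P.real {ω | Q₁ 0 ω = i ∧ Q₂ 0 ω = j} =
      ∫ ω, ((if 1 ≤ i then 1 else 0) * visits Q₁ Q₂ A (i - 1) j t ω +
      (if i = n ∧ j = 1 then 1 else 0) * visits Q₁ Q₂ A n 0 t ω -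
      (if i = n ∧ j = 1 then 0 else 1) * visits Q₁ Q₂ A i j t ω +
      ((if 1 ≤ i ∧ j = 0 then 1 else 0) * visits Q₁ Q₂ D (i - 1) 1 t ω -
      (if i < n ∧ j = 1 then 1 else 0) * visits Q₁ Q₂ D i 1 t ω) +
      ∑ l : Fin n, ((if i < n then 1 else 0) * ((if (l : ℕ) < i + 1 then 1 else 0) *
        visits Q₁ Q₂ (π l) (i + 1) j t ω) -
      (if (l : ℕ) < i then 1 else 0) * visits Q₁ Q₂ (π l) i j t ω)) ∂P := by
    rw [← hQ.integral_stateIndicator, ← hQ.integral_stateIndicator, ← integral_sub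
      (hQ.integrable_stateIndicator i j t) (hQ.integrable_stateIndicator i j 0)]
    refine integral_congr_ae ?_
    filter_upwards [hQ.ae_isRetrialPath] with ω hω
    exact hω.indicator_balance hi hj t
  rw [integral_balance_terms i1 i2 i3 i4 i5 i6 i7] at key
  simp only [integral_const_mul, hQ.integral_visits_services, Finset.sum_sub_distrib] at key
  rw [← Finset.mul_sum, sum_fin_ite_lt hi] at key
  -- The count of indices below i + 1 needs i + 1 ≤ n, which is what the guard i < n supplies.
  have hsum : ∀ c : ℝ, (if i < n then (1 : ℝ) else 0) *
      ∑ l : Fin n, (if (l : ℕ) < i + 1 then 1 else 0) * c =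
      (if i < n then (1 : ℝ) else 0) * ((i + 1) * c) := fun c => by
    by_cases h : i < n
    · rw [sum_fin_ite_lt h]
      push_cast
      rfl
    · simp [h]
  rw [hsum] at key
  rw [key]
  unfold rate freq
  ring

/-- Excluding (n, 1) makes both visit counts integrable, so the expectation of the difference
splits. -/
lemma rateDiff_eq (hQ : IsRetrialSystem n μ F P A D π Q₁ Q₂ Q₃) {i j i' j' : ℕ}
    (h : (i, j) ≠ (n, 1)) (h' : (i', j') ≠ (n, 1)) (t : ℝ≥0) :
    rateDiff P Q₁ Q₂ A i j i' j' t = rate P Q₁ Q₂ A i j t - rate P Q₁ Q₂ A i' j' t := by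
  unfold rateDiff rate
  rw [← mul_sub, ← integral_sub (hQ.integrable_visits_arrivals h t)
    (hQ.integrable_visits_arrivals h' t)]
  congr 1
  refine integral_congr_ae ?_
  filter_upwards [hQ.arrivals.path] with ω hω
  exact hω.pathIntegral_sub _ _ t

/-- The difference of two probabilities lies in [-1, 1]. -/
lemma tendsto_mean_increment (P : Measure Ω) [IsProbabilityMeasure P] (Q₁ Q₂ : ℝ≥0 → Ω → ℕ)
    (i j : ℕ) : Tendsto (fun t : ℝ≥0 => (t : ℝ)⁻¹ * (P.real {ω | Q₁ t ω = i ∧ Q₂ t ω = j} -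
      P.real {ω | Q₁ 0 ω = i ∧ Q₂ 0 ω = j})) atTop (𝓝 0) := by
  have h : Tendsto (fun t : ℝ≥0 => (t : ℝ)⁻¹) atTop (𝓝 0) :=
    tendsto_inv_atTop_zero.comp (NNReal.tendsto_coe_atTop.2 tendsto_id)
  refine squeeze_zero_norm (fun t => ?_) h
  rw [norm_mul, Real.norm_eq_abs, abs_of_nonneg (inv_nonneg.2 t.coe_nonneg)]
  refine mul_le_of_le_one_right (inv_nonneg.2 t.coe_nonneg) ?_
  rw [Real.norm_eq_abs, abs_le]
  have h1 := measureReal_le_one (μ := P) (s := {ω | Q₁ t ω = i ∧ Q₂ t ω = j})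
  have h2 := measureReal_le_one (μ := P) (s := {ω | Q₁ 0 ω = i ∧ Q₂ 0 ω = j})
  have h3 := measureReal_nonneg (μ := P) (s := {ω | Q₁ t ω = i ∧ Q₂ t ω = j})
  have h4 := measureReal_nonneg (μ := P) (s := {ω | Q₁ 0 ω = i ∧ Q₂ 0 ω = j})
  constructor <;> linarith

end IsRetrialSystem

end System

end RetrialQueue

/-! ### The limit equations -/

theorem theorem1 {Ω : Type*} [mΩ : MeasurableSpace Ω] (P : Measure Ω) [IsProbabilityMeasure P]
    (F : Filtration ℝ≥0 mΩ) (n : ℕ) (hn : 1 ≤ n) (μ : ℝ≥0) (hμ : 0 < μ)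
    (A D : ℝ≥0 → Ω → ℕ) (π : Fin n → ℝ≥0 → Ω → ℕ) (Q₁ Q₂ Q₃ : ℝ≥0 → Ω → ℕ)
    (hQ : IsRetrialSystem n μ F P A D π Q₁ Q₂ Q₃) :
    -- the expectations below are finite
    (∀ i j : ℕ, i ≤ n → j ≤ 1 → (i, j) ≠ (n, 1) → ∀ t, Integrable (visits Q₁ Q₂ A i j t) P) ∧
    (∀ i : ℕ, i < n → ∀ t, Integrable (visits Q₁ Q₂ D i 1 t) P) ∧
    -- the equations hold asymptotically, whether or not the individual limits exist
    (∀ j : ℕ, j ≤ 1 → Tendsto (fun t : ℝ≥0 =>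
        μ * freq P Q₁ Q₂ 1 j t -
          (rate P Q₁ Q₂ A 0 j t + j * rate P Q₁ Q₂ D 0 j t)) atTop (𝓝 0)) ∧
    (∀ i j : ℕ, 1 ≤ i → i ≤ n - 1 → j ≤ 1 → Tendsto (fun t : ℝ≥0 =>
        (i * μ * freq P Q₁ Q₂ i j t - (i + 1) * μ * freq P Q₁ Q₂ (i + 1) j t) -
          (rateDiff P Q₁ Q₂ A (i - 1) j i j t + (1 - j) * rate P Q₁ Q₂ D (i - 1) 1 t
            - j * rate P Q₁ Q₂ D i 1 t)) atTop (𝓝 0)) ∧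
    Tendsto (fun t : ℝ≥0 =>
        n * μ * freq P Q₁ Q₂ n 0 t -
          (rateDiff P Q₁ Q₂ A (n - 1) 0 n 0 t + rate P Q₁ Q₂ D (n - 1) 1 t)) atTop (𝓝 0) ∧
    Tendsto (fun t : ℝ≥0 =>
        n * μ * freq P Q₁ Q₂ n 1 t -
          (rate P Q₁ Q₂ A (n - 1) 1 t + rate P Q₁ Q₂ A n 0 t)) atTop (𝓝 0) ∧
    -- the equations between the limits, wherever these exist
    (∀ j : ℕ, j ≤ 1 → ∀ p a d : ℝ,
        Tendsto (freq P Q₁ Q₂ 1 j) atTop (𝓝 p) →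
        Tendsto (rate P Q₁ Q₂ A 0 j) atTop (𝓝 a) →
        (j = 1 → Tendsto (rate P Q₁ Q₂ D 0 j) atTop (𝓝 d)) →
        μ * p = a + j * d) ∧
    (∀ i j : ℕ, 1 ≤ i → i ≤ n - 1 → j ≤ 1 → ∀ p p' a d d' : ℝ,
        Tendsto (freq P Q₁ Q₂ i j) atTop (𝓝 p) →
        Tendsto (freq P Q₁ Q₂ (i + 1) j) atTop (𝓝 p') →
        Tendsto (rateDiff P Q₁ Q₂ A (i - 1) j i j) atTop (𝓝 a) →
        (j = 0 → Tendsto (rate P Q₁ Q₂ D (i - 1) 1) atTop (𝓝 d)) →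
        (j = 1 → Tendsto (rate P Q₁ Q₂ D i 1) atTop (𝓝 d')) →
        i * μ * p - (i + 1) * μ * p' = a + (1 - j) * d - j * d') ∧
    (∀ p a d : ℝ,
        Tendsto (freq P Q₁ Q₂ n 0) atTop (𝓝 p) →
        Tendsto (rateDiff P Q₁ Q₂ A (n - 1) 0 n 0) atTop (𝓝 a) →
        Tendsto (rate P Q₁ Q₂ D (n - 1) 1) atTop (𝓝 d) →
        n * μ * p = a + d) ∧
    (∀ p a a' : ℝ,
        Tendsto (freq P Q₁ Q₂ n 1) atTop (𝓝 p) →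
        Tendsto (rate P Q₁ Q₂ A (n - 1) 1) atTop (𝓝 a) →
        Tendsto (rate P Q₁ Q₂ A n 0) atTop (𝓝 a') →
        n * μ * p = a + a') := by

  have bal := fun (i j : ℕ) (hi : i ≤ n) (hj : j ≤ 1) =>
    (IsRetrialSystem.tendsto_mean_increment P Q₁ Q₂ i j).congr (hQ.mean_balance hi hj)
  have lim_zero : ∀ j : ℕ, j ≤ 1 → Tendsto (fun t : ℝ≥0 =>
      μ * freq P Q₁ Q₂ 1 j t -
        (rate P Q₁ Q₂ A 0 j t + j * rate P Q₁ Q₂ D 0 j t)) atTop (𝓝 0) := by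
    intro j hj
    refine (bal 0 j (Nat.zero_le n) hj).congr fun t => ?_
    have h0 : 0 < n := hn
    have h0' : 0 ≠ n := h0.ne
    interval_cases j <;> simp [h0, h0'] <;> ring
  have lim_mid : ∀ i j : ℕ, 1 ≤ i → i ≤ n - 1 → j ≤ 1 → Tendsto (fun t : ℝ≥0 =>
      (i * μ * freq P Q₁ Q₂ i j t - (i + 1) * μ * freq P Q₁ Q₂ (i + 1) j t) -
        (rateDiff P Q₁ Q₂ A (i - 1) j i j t + (1 - j) * rate P Q₁ Q₂ D (i - 1) 1 t
          - j * rate P Q₁ Q₂ D i 1 t)) atTop (𝓝 0) := by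
    intro i j hi hi' hj
    have h1 : i < n := by omega
    have h2 : i ≠ n := h1.ne
    have h3 : i - 1 ≠ n := by omega
    -- The mean balance is inflow minus outflow, while the claim has the service terms of (i, j), an
    -- outflow, with positive sign; hence the negation. For i = 0 the service term is an inflow and
    -- the signs already agree.
    rw [← neg_zero]
    refine (bal i j h1.le hj).neg.congr fun t => ?_
    rw [hQ.rateDiff_eq (by simp [h3]) (by simp [h2])]
    interval_cases j <;> simp [h1, h2, hi] <;> ring
  have lim_full : Tendsto (fun t : ℝ≥0 => n * μ * freq P Q₁ Q₂ n 0 t -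
      (rateDiff P Q₁ Q₂ A (n - 1) 0 n 0 t + rate P Q₁ Q₂ D (n - 1) 1 t)) atTop (𝓝 0) := by
    rw [← neg_zero]
    refine (bal n 0 le_rfl zero_le_one).neg.congr fun t => ?_
    rw [hQ.rateDiff_eq (by simp) (by simp)]
    simp [hn]
    ring
  have lim_last : Tendsto (fun t : ℝ≥0 => n * μ * freq P Q₁ Q₂ n 1 t -
      (rate P Q₁ Q₂ A (n - 1) 1 t + rate P Q₁ Q₂ A n 0 t)) atTop (𝓝 0) := by
    rw [← neg_zero]
    refine (bal n 1 le_rfl le_rfl).neg.congr fun t => ?_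
    simp [hn]
    ring
  refine ⟨fun i j _ _ hij t => hQ.integrable_visits_arrivals hij t,
    fun i hi t => hQ.integrable_visits_retrials hi t, lim_zero, lim_mid, lim_full, lim_last,
    ?_, ?_, ?_, ?_⟩
  · intro j hj p a d hp ha hd
    -- For j = 0 no limit of the retrial rate is assumed; the coefficient 0 removes the term
    -- whatever d is.
    have hd' : Tendsto (fun t => (j : ℝ) * rate P Q₁ Q₂ D 0 j t) atTop (𝓝 (j * d)) := by
      interval_cases j
      · simp
      · exact (hd rfl).const_mul _
    exact sub_eq_zero.1 (tendsto_nhds_unique ((hp.const_mul (μ : ℝ)).sub (ha.add hd'))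
      (lim_zero j hj))
  · intro i j hi hi' hj p p' a d d' hp hp' ha hd hd'
    have e1 : Tendsto (fun t => (1 - (j : ℝ)) * rate P Q₁ Q₂ D (i - 1) 1 t) atTop
        (𝓝 ((1 - j) * d)) := by
      interval_cases j
      · exact (hd rfl).const_mul _
      · simp
    have e2 : Tendsto (fun t => (j : ℝ) * rate P Q₁ Q₂ D i 1 t) atTop (𝓝 (j * d')) := by
      interval_cases j
      · simp
      · exact (hd' rfl).const_mul _
    exact sub_eq_zero.1 (tendsto_nhds_unique
      (((hp.const_mul (i * μ : ℝ)).sub (hp'.const_mul ((i + 1) * μ : ℝ))).sub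
        ((ha.add e1).sub e2)) (lim_mid i j hi hi' hj))
  · intro p a d hp ha hd
    exact sub_eq_zero.1 (tendsto_nhds_unique ((hp.const_mul (n * μ : ℝ)).sub (ha.add hd)) lim_full)
  · intro p a a' hp ha ha'
    exact sub_eq_zero.1 (tendsto_nhds_unique ((hp.const_mul (n * μ : ℝ)).sub (ha.add ha')) lim_last)
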